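/- Let $\mathbb T^d=(\mathbb R/\mathbb Z)^d$, let $m,n\in\mathbb N$, and for each mode $i\in\{0,\dots,m-1\}$ let $H_i:\mathbb T^d\to\mathbb R^d$ and $\sigma_i:\mathbb T^d\to\mathbb R^{d\times n}$ be measurable. **Modes.** Assume that for each $i$ the diffusion $$dX_t=H_i(X_t)\,dt+\sigma_i(X_t)\,dB_t$$ on $\mathbb T^d$ is well posed in law: there is a measurable family $(\mathbf P^i_x)_{x\in\mathbb T^d}$ of probability measures on $C([0,\infty),\mathbb T^d)$ such that for each probability measure $\nu$ on $\mathbb T^d$ the law $\int \mathbf P^i_x\,\nu(dx)$ is the unique solution with initial law $\nu$ of the martingale problem for $$L_i f=\sum_k (H_i)_k\,\partial_k f+\tfrac12\sum_{k,l}(\sigma_i\sigma_i^{T})_{kl}\,\partial_k\partial_l f .$$ (A probability measure on paths solves this problem if for all $f\in C^2(\mathbb T^d)$ and all $t\ge 0$ one has $\mathbb E\int_0^t|L_if(X_s)|\,ds<\infty$, and $f(X_t)-f(X_0)-\int_0^tL_if(X_s)\,ds$ is a martingale in the natural filtration of the path.) Write $P^i_t(x,\cdot)$ for the law of $X_t$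 under $\mathbf P^i_x$. **Switched process.** Let $I$ be a continuous-time Markov chain on $\{0,\dots,m-1\}$ with constant jump rates $Q_{ij}\ge 0$ ($i\ne j$), and let $(X_t,I_t)_{t\ge0}$ be the switched process on $\mathbb T^d\times\{0,\dots,m-1\}$, $$dX_t=H_{I_t}(X_t)\,dt+\sigma_{I_t}(X_t)\,dB_t ,$$ with $B$ independent of $I$. It is defined by induction along the jump times $0=T_0<T_1<\cdots$ of $I$: on $[T_k,T_{k+1})$ the mode is constant, equal to $i=I_{T_k}$, and, given the past, $X$ follows there a path of law $\mathbf P^{i}_{x}$ with $x=X_{T_k}$, independent of the holding time $T_{k+1}-T_k$ (exponential of parameter $q_i=\sum_{j\neq i}Q_{ij}$, and infinite if $q_i=0$) and of the next mode (equal to $j\ne i$ with probability $Q_{ij}/q_i$); at $T_{k+1}$ the position does not jump. **Claim.** Suppose that $I$ is irreducible and that for some mode $i_0$ the diffusion satisfies the Doeblin condition: there are $t_0>0$, $c>0$ and a probability measure $\mu$ on $\mathbb T^d$ with $P^{i_0}_{t_0}(x,\cdot)\ge c\,\mu$ for all $x\in\mathbb T^d$. Then the switched process has a unique invariant probability measure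 $\pi$, that is, a unique probability measure $\pi$ on $\mathbb T^d\times\{0,\dots,m-1\}$ such that $(X_t,I_t)$ has law $\pi$ for all $t\ge 0$ if $(X_0,I_0)$ has law $\pi$. Moreover there are constants $C,r>0$ such that for each initial law $\nu$ of $(X_0,I_0)$ and all $t\ge 0$ $$\sup_A\big|\mathbb P_\nu\big((X_t,I_t)\in A\big)-\pi(A)\big|\le C e^{-rt},$$ where the supremum is over the measurable sets $A$. -/

import Mathlib

open MeasureTheory ProbabilityTheory
open scoped ENNReal NNReal Matrix

noncomputable section

namespace SwitchedDiffusion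

/-- The `d`-dimensional torus `(ℝ / ℤ) ^ d`. -/
abbrev Torus (d : ℕ) : Type := UnitAddTorus (Fin d)

/-- Continuous paths `[0, ∞) → 𝕋 ^ d`, with the `σ`-algebra generated by the evaluations
(the one that a subtype of a product carries). -/
abbrev Path (d : ℕ) : Type := {ω : ℝ≥0 → Torus d // Continuous ω}

/-- The position at time `t` of a path. -/
def Path.eval {d : ℕ} (t : ℝ≥0) (ω : Path d) : Torus d := ω.1 t

lemma Path.measurable_eval {d : ℕ} (t : ℝ≥0) : Measurable (Path.eval (d := d) t) :=
  (measurable_pi_apply t).comp measurable_subtype_coe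

lemma Path.measurable_uncurry_eval {d : ℕ} :
    Measurable fun p : ℝ≥0 × Path d => Path.eval p.1 p.2 := by
  have h : Measurable (Function.uncurry fun (t : ℝ≥0) (ω : Path d) => Path.eval t ω) :=
    measurable_uncurry_of_continuous_of_measurable (u := fun (t : ℝ≥0) (ω : Path d) => Path.eval t ω)
      (fun ω => ω.2) Path.measurable_eval
  exact h

/-! ### Diffusions on the torus: the martingale problem -/

/-- The partial derivative `∂_k f` of a function on the torus. -/
def partialDeriv {d : ℕ} (k : Fin d) (f : Torus d → ℝ) (x : Torus d) : ℝ :=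
  deriv (fun s : ℝ => f (x + Pi.single k (s : UnitAddCircle))) 0

/-- `f` is of class `C²` on the torus, i.e. its `ℤ ^ d`-periodic lift to `ℝ ^ d` is `C²`. -/
def IsC2 {d : ℕ} (f : Torus d → ℝ) : Prop :=
  ContDiff ℝ 2 fun y : Fin d → ℝ => f fun k => (y k : UnitAddCircle)

/-- The generator of `dX = b(X) dt + σ(X) dB`, namely
`L f = ∑ k, b_k ∂_k f + 1/2 ∑ k l, (σ σᵀ)_{kl} ∂_k ∂_l f`. -/
def generator {d n : ℕ} (b : Torus d → Fin d → ℝ) (σ : Torus d → Matrix (Fin d) (Fin n) ℝ)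
    (f : Torus d → ℝ) (x : Torus d) : ℝ :=
  ∑ k, b x k * partialDeriv k f x +
    (1 / 2) * ∑ k, ∑ l, (σ x * (σ x)ᵀ) k l * partialDeriv k (partialDeriv l f) x

/-- The natural filtration of the coordinate process on path space. -/
def canonicalFiltration (d : ℕ) :
    Filtration ℝ≥0 (inferInstance : MeasurableSpace (Path d)) :=
  Filtration.natural (Path.eval (d := d)) fun t => (Path.measurable_eval t).stronglyMeasurable

/-- The process `M^f_t = f(ω_t) - f(ω_0) - ∫₀ᵗ L f(ω_s) ds`. -/
def martingaleProcess {d n : ℕ} (b : Torus d → Fin d → ℝ)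
    (σ : Torus d → Matrix (Fin d) (Fin n) ℝ) (f : Torus d → ℝ) (t : ℝ≥0) (ω : Path d) : ℝ :=
  f (ω.eval t) - f (ω.eval 0) - ∫ s in (0 : ℝ)..t, generator b σ f (ω.eval s.toNNReal)

/-- `R` is the law of a solution of `dX = b(X) dt + σ(X) dB` with `X_0` of law `ν`,
in the sense of the martingale problem: `R` has initial marginal `ν` and, for each `C²`
function `f`, `L f` is integrable along the path and `M^f` is a martingale. -/
structure IsSolution {d n : ℕ} (b : Torus d → Fin d → ℝ)
    (σ : Torus d → Matrix (Fin d) (Fin n) ℝ) (ν : Measure (Torus d)) (R : Measure (Path d)) :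
    Prop where
  initial : R.map (Path.eval 0) = ν
  integrable : ∀ f : Torus d → ℝ, IsC2 f → ∀ t : ℝ≥0,
    lintegral R (fun ω => ∫⁻ s in Set.Icc (0 : ℝ) t, ‖generator b σ f (ω.eval s.toNNReal)‖ₑ) < ∞
  martingale : ∀ f : Torus d → ℝ, IsC2 f →
    Martingale (martingaleProcess b σ f) (canonicalFiltration d) R

/-- The equation `dX = b(X) dt + σ(X) dB` is well posed, and `P x` is the law on path space of
its solution started from `x`: for each initial law `ν` the mixture of the `P x` with weights `ν`
is a solution, and it is the only one. -/
structure IsDiffusion {d n : ℕ} (b : Torus d → Fin d → ℝ)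
    (σ : Torus d → Matrix (Fin d) (Fin n) ℝ) (P : Kernel (Torus d) (Path d)) : Prop where
  exists_solution : ∀ ν : Measure (Torus d), IsProbabilityMeasure ν →
    IsSolution b σ ν (ν.bind P)
  unique_solution : ∀ ν : Measure (Torus d), IsProbabilityMeasure ν →
    ∀ R : Measure (Path d), IsProbabilityMeasure R → IsSolution b σ ν R → R = ν.bind P

/-- The semigroup of the diffusion: `δ_x P_t` is the law at time `t` of the solution started
from `x`. -/
def semigroup {d : ℕ} (P : Kernel (Torus d) (Path d)) (t : ℝ≥0) : Kernel (Torus d) (Torus d) :=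
  P.map (Path.eval t)

/-- The Doeblin condition: `δ_x P_{t₀} ≥ c μ` for all `x`, for some `t₀ > 0`, `c > 0` and some
probability measure `μ`. -/
def Doeblin {d : ℕ} (P : Kernel (Torus d) (Path d)) : Prop :=
  ∃ t₀ : ℝ≥0, 0 < t₀ ∧ ∃ c : ℝ≥0, 0 < c ∧ ∃ μ : Measure (Torus d), IsProbabilityMeasure μ ∧
    ∀ x, c • μ ≤ semigroup P t₀ x

/-! ### The mode: a Markov chain in continuous time -/

/-- The matrix of jump rates (`Q`-matrix) of a Markov chain in continuous time on
`{0, …, m - 1}`. -/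
structure RateMatrix (m : ℕ) where
  rate : Fin m → Fin m → ℝ
  rate_nonneg : ∀ i j, i ≠ j → 0 ≤ rate i j
  row_sum : ∀ i, ∑ j, rate i j = 0

namespace RateMatrix

variable {m : ℕ} (Q : RateMatrix m)

/-- Each mode can be reached from each mode through jumps of positive rate. -/
def Irreducible : Prop :=
  ∀ i j, Relation.ReflTransGen (fun a b => a ≠ b ∧ 0 < Q.rate a b) i j

/-- The total rate `q_i = -Q_{ii} = ∑_{j ≠ i} Q_{ij}` at which the chain leaves `i`. -/
def exitRate (i : Fin m) : ℝ := -Q.rate i i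

/-- The law of the holding time in `i`: exponential of parameter `q_i`, and the constant `∞` if
`q_i = 0`. -/
def holdingLaw (i : Fin m) : Measure ℝ≥0∞ :=
  if 0 < Q.exitRate i then (expMeasure (Q.exitRate i)).map ENNReal.ofReal else Measure.dirac ∞

/-- The law of the mode after a jump from `i`: it is `j ≠ i` with probability `Q_{ij} / q_i`
(if `q_i = 0` then there is no jump, and the value is irrelevant). -/
def jumpLaw (i : Fin m) : Measure (Fin m) :=
  if 0 < Q.exitRate i then
    ∑ j ∈ Finset.univ.erase i, ENNReal.ofReal (Q.rate i j / Q.exitRate i) • Measure.dirac j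
  else Measure.dirac i

instance (i : Fin m) : IsProbabilityMeasure (Q.holdingLaw i) := by
  unfold holdingLaw
  split_ifs with h
  · have := isProbabilityMeasure_expMeasure h
    exact Measure.isProbabilityMeasure_map ENNReal.measurable_ofReal.aemeasurable
  · infer_instance

instance (i : Fin m) : IsProbabilityMeasure (Q.jumpLaw i) := by
  unfold jumpLaw
  split_ifs with h
  · constructor
    have h1 : ∑ j ∈ Finset.univ.erase i, Q.rate i j = Q.exitRate i := by
      have := Finset.add_sum_erase Finset.univ (Q.rate i) (Finset.mem_univ i)
      rw [Q.row_sum i] at this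
      unfold exitRate
      linarith
    have h2 : ∀ j ∈ Finset.univ.erase i, 0 ≤ Q.rate i j / Q.exitRate i := fun j hj =>
      div_nonneg (Q.rate_nonneg i j (Finset.ne_of_mem_erase hj).symm) h.le
    simp only [Measure.coe_finsetSum, Finset.sum_apply, Measure.smul_apply, measure_univ,
      smul_eq_mul, mul_one]
    rw [← ENNReal.ofReal_sum_of_nonneg h2, ← Finset.sum_div, h1, div_self h.ne',
      ENNReal.ofReal_one]
  · infer_instance

/-- The holding laws as a kernel. -/
def holdingKernel : Kernel (Fin m) ℝ≥0∞ := ⟨Q.holdingLaw, measurable_of_finite _⟩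

/-- The jump laws as a kernel. -/
def jumpKernel : Kernel (Fin m) (Fin m) := ⟨Q.jumpLaw, measurable_of_finite _⟩

instance : IsMarkovKernel Q.holdingKernel :=
  ⟨fun i => inferInstanceAs (IsProbabilityMeasure (Q.holdingLaw i))⟩

instance : IsMarkovKernel Q.jumpKernel :=
  ⟨fun i => inferInstanceAs (IsProbabilityMeasure (Q.jumpLaw i))⟩

end RateMatrix

/-! ### The switched process, by induction along the jump times of the mode -/

/-- The state space of the switched process `(X, I)`. -/
abbrev State (d m : ℕ) : Type := Torus d × Fin m

/-- What is drawn at a jump time of the mode: a path of the diffusion in the current mode, the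
time that the mode is kept, and the mode. -/
abbrev Stage (d m : ℕ) : Type := Path d × ℝ≥0∞ × Fin m

section Construction

variable {d m : ℕ}

/-- `(x, i)` is sent to the law `P i x` of the diffusion of mode `i` started from `x`. -/
def modeKernel (P : Fin m → Kernel (Torus d) (Path d)) : Kernel (State d m) (Path d) :=
  ⟨fun z => P z.2 z.1, measurable_from_prod_countable_left fun i => (P i).measurable⟩

instance (P : Fin m → Kernel (Torus d) (Path d)) [∀ i, IsMarkovKernel (P i)] :
    IsMarkovKernel (modeKernel P) :=
  ⟨fun z => inferInstanceAs (IsProbabilityMeasure (P z.2 z.1))⟩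

/-- The stage that begins in `(x, i)`: a path of the diffusion of mode `i` started from `x`, an
independent holding time of law `Q.holdingLaw i`, and the mode `i`. -/
def stageKernel (Q : RateMatrix m) (P : Fin m → Kernel (Torus d) (Path d)) :
    Kernel (State d m) (Stage d m) :=
  modeKernel P ×ₖ
    (Q.holdingKernel.comap Prod.snd measurable_snd ×ₖ Kernel.deterministic Prod.snd measurable_snd)

instance (Q : RateMatrix m) (P : Fin m → Kernel (Torus d) (Path d)) [∀ i, IsMarkovKernel (P i)] :
    IsMarkovKernel (stageKernel Q P) := by
  unfold stageKernel; infer_instance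

/-- The position at the end of a stage. -/
def Stage.endpoint (s : Stage d m) : Torus d := s.1.eval s.2.1.toNNReal

lemma Stage.measurable_endpoint : Measurable (Stage.endpoint (d := d) (m := m)) :=
  Path.measurable_uncurry_eval.comp
    ((ENNReal.measurable_toNNReal.comp measurable_snd.fst).prodMk measurable_fst)

/-- The state just after the jump that ends a stage: the position does not jump, and the new mode
has law `Q.jumpLaw i`, where `i` is the old one. -/
def jumpStateKernel (Q : RateMatrix m) : Kernel (Stage d m) (State d m) :=
  Kernel.deterministic Stage.endpoint Stage.measurable_endpoint ×ₖ
    Q.jumpKernel.comap (fun s => s.2.2) measurable_snd.snd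

instance (Q : RateMatrix m) : IsMarkovKernel (jumpStateKernel (d := d) Q) := by
  unfold jumpStateKernel; infer_instance

/-- The law of the next stage given the stages up to the `n`-th: it depends on the `n`-th only. -/
def nextStageKernel (Q : RateMatrix m) (P : Fin m → Kernel (Torus d) (Path d)) (n : ℕ) :
    Kernel (Finset.Iic n → Stage d m) (Stage d m) :=
  (stageKernel Q P ∘ₖ jumpStateKernel Q).comap (fun h => h ⟨n, Finset.mem_Iic.2 le_rfl⟩)
    (measurable_pi_apply _)

instance (Q : RateMatrix m) (P : Fin m → Kernel (Torus d) (Path d)) [∀ i, IsMarkovKernel (P i)]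
    (n : ℕ) : IsMarkovKernel (nextStageKernel Q P n) := by
  unfold nextStageKernel; infer_instance

/-- The law of the sequence of all stages, when the initial state has law `ν`. -/
def stageMeasure (Q : RateMatrix m) (P : Fin m → Kernel (Torus d) (Path d))
    [∀ i, IsMarkovKernel (P i)] (ν : Measure (State d m)) : Measure (ℕ → Stage d m) :=
  Kernel.trajMeasure (X := fun _ => Stage d m) (ν.bind (stageKernel Q P)) (nextStageKernel Q P)

/-- The `n`-th jump time of the mode (with `T_0 = 0`). -/
def jumpTime (e : ℕ → Stage d m) (n : ℕ) : ℝ≥0∞ := ∑ k ∈ Finset.range n, (e k).2.1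

/-- The number of jumps of the mode up to time `t`, i.e. the first `n` with `t < T_{n+1}`
(and `0` in the null event that the mode jumps infinitely often before `t`). -/
def jumpCount (t : ℝ≥0) (e : ℕ → Stage d m) : ℕ := sInf {n | (t : ℝ≥0∞) < jumpTime e (n + 1)}

/-- The switched process `(X_t, I_t)`: if `T_n ≤ t < T_{n+1}` then `I_t` is the `n`-th mode and
`X_t` is the position at time `t - T_n` of the `n`-th path. -/
def switchedProcess (t : ℝ≥0) (e : ℕ → Stage d m) : State d m :=
  ((e (jumpCount t e)).1.eval (t - (jumpTime e (jumpCount t e)).toNNReal),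
    (e (jumpCount t e)).2.2)

lemma measurable_jumpTime (n : ℕ) : Measurable fun e : ℕ → Stage d m => jumpTime e n :=
  Finset.measurable_sum _ fun k _ => (measurable_pi_apply k).snd.fst

lemma measurable_jumpCount (t : ℝ≥0) : Measurable (jumpCount (d := d) (m := m) t) := by
  have hs : ∀ n, MeasurableSet {e : ℕ → Stage d m | (t : ℝ≥0∞) < jumpTime e (n + 1)} := fun n =>
    measurableSet_lt measurable_const (measurable_jumpTime _)
  refine measurable_of_Iic fun N => ?_
  have : jumpCount t ⁻¹' Set.Iic N =
      (⋃ n ∈ Set.Iic N, {e : ℕ → Stage d m | (t : ℝ≥0∞) < jumpTime e (n + 1)}) ∪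
        (⋂ n, {e : ℕ → Stage d m | (t : ℝ≥0∞) < jumpTime e (n + 1)}ᶜ) := by
    ext e
    simp only [Set.mem_preimage, Set.mem_Iic, Set.mem_union, Set.mem_iUnion, Set.mem_ofPred_eq,
      Set.mem_iInter, Set.mem_compl_iff, jumpCount]
    constructor
    · intro h
      by_cases hne : {n | (t : ℝ≥0∞) < jumpTime e (n + 1)}.Nonempty
      · exact Or.inl ⟨_, h, Nat.sInf_mem hne⟩
      · exact Or.inr fun n hn => hne ⟨n, hn⟩
    · rintro (⟨n, hn, h⟩ | h)
      · exact (Nat.sInf_le h).trans hn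
      · have : {n | (t : ℝ≥0∞) < jumpTime e (n + 1)} = ∅ :=
          Set.eq_empty_of_forall_notMem fun n hn => h n hn
        simp [this]
  rw [this]
  exact (MeasurableSet.biUnion (Set.to_countable _) fun n _ => hs n).union
    (MeasurableSet.iInter fun n => (hs n).compl)

lemma measurable_switchedProcess (t : ℝ≥0) :
    Measurable (switchedProcess (d := d) (m := m) t) := by
  have hN := measurable_jumpCount (d := d) (m := m) t
  have hs : Measurable fun e : ℕ → Stage d m => e (jumpCount t e) :=
    (measurable_from_prod_countable_right (f := fun p : ℕ × (ℕ → Stage d m) => p.2 p.1)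
      fun n => measurable_pi_apply n).comp (hN.prodMk measurable_id)
  have hT : Measurable fun e : ℕ → Stage d m => jumpTime e (jumpCount t e) :=
    (measurable_from_prod_countable_right (f := fun p : ℕ × (ℕ → Stage d m) => jumpTime p.2 p.1)
      measurable_jumpTime).comp (hN.prodMk measurable_id)
  have hu : Measurable fun e : ℕ → Stage d m => t - (jumpTime e (jumpCount t e)).toNNReal :=
    measurable_const.sub hT.ennreal_toNNReal
  have hx : Measurable fun e : ℕ → Stage d m => (switchedProcess t e).1 :=
    Path.measurable_uncurry_eval.comp (hu.prodMk hs.fst)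
  have hi : Measurable fun e : ℕ → Stage d m => (switchedProcess t e).2 := hs.snd.snd
  exact hx.prodMk hi

/-- The law of `(X_t, I_t)` when `(X_0, I_0)` has law `ν`. -/
def switchedLaw (Q : RateMatrix m) (P : Fin m → Kernel (Torus d) (Path d))
    [∀ i, IsMarkovKernel (P i)] (ν : Measure (State d m)) (t : ℝ≥0) : Measure (State d m) :=
  (stageMeasure Q P ν).map (switchedProcess t)

/-- `π` is an invariant probability measure of the switched process. -/
def IsInvariantProbability (Q : RateMatrix m) (P : Fin m → Kernel (Torus d) (Path d))
    [∀ i, IsMarkovKernel (P i)] (π : Measure (State d m)) : Prop :=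
  IsProbabilityMeasure π ∧ ∀ t : ℝ≥0, switchedLaw Q P π t = π

end Construction

/-- The total variation distance `sup_A |μ(A) - ν(A)|` between probability measures. -/
def tvDist {E : Type*} [MeasurableSpace E] (μ ν : Measure E) : ℝ :=
  ⨆ A : {A : Set E // MeasurableSet A}, |μ.real A.1 - ν.real A.1|

end SwitchedDiffusion

end

/-! The switched process inherits the Doeblin condition from mode `i₀`. From any state the mode is
`i₀` at time `1` with probability at least some `p₀ > 0`: irreducibility gives a positive bound for
each initial mode, uniform in the position, and there are finitely many modes. With positive
probability the mode then stays `i₀` for a further time `t₀`, during which the position moves by the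
semigroup of `i₀`, which dominates `c μ`. Hence all transition laws at time `1 + t₀` dominate one
nonzero measure (`exists_minorant_switchedKernel`), and Doeblin's theorem for semigroups
(`exists_invariant_exponential_of_minorant`) concludes.

Most of the work is to show that the law built from stages comes from a Markov semigroup. For one
mode, the path seen from time `s` on solves the martingale problem started from the law of `X_s`;
uniqueness for that initial law gives Chapman–Kolmogorov (`IsDiffusion.semigroup_add`). For the
switched process, expectations are split by the number `n` of jumps. Conditioning on the first jump
gives a recursion for `stateExpect` in which each diffusion enters only through its semigroup
(`stateExpect_zero`, `stateExpect_succ`). Lack of memory of the holding times, Chapman–Kolmogorov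
and induction on `n` then give the flow property with jump counts (`stateExpect_add`). Almost surely
finitely many jumps occur in bounded time (`ae_exists_lt_jumpTime`), so summing over `n` recovers
the whole law (`lintegral_switchedLaw`) and its semigroup property (`switchedKernel_add`). -/

noncomputable section

namespace SwitchedDiffusion

/-! ### Doeblin's theorem for a semigroup of Markov kernels -/

section Doeblin

variable {E : Type*} [MeasurableSpace E]

/-- The part of a kernel that is left after the removal of a common lower bound. -/
def residual (κ : Kernel E E) (μ : Measure E) [IsFiniteMeasure μ] (h : ∀ x, μ ≤ κ x) :
    Kernel E E :=
  ⟨fun x => κ x - μ, Measure.measurable_of_measurable_coe _ fun A hA => by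
    simp_rw [Measure.sub_apply hA (h _)]
    exact (κ.measurable_coe hA).sub_const _⟩

variable {κ : Kernel E E} {μ : Measure E} [IsFiniteMeasure μ] (h : ∀ x, μ ≤ κ x)

lemma residual_add (x : E) : residual κ μ h x + μ = κ x :=
  Measure.sub_add_cancel_of_le (h x)

lemma residual_univ [IsMarkovKernel κ] (x : E) :
    residual κ μ h x Set.univ = 1 - μ Set.univ := by
  change (κ x - μ) Set.univ = _
  rw [Measure.sub_apply .univ (h x), measure_univ]

omit [IsFiniteMeasure μ] in
include h in
lemma minorant_univ_le_one [IsMarkovKernel κ] (x : E) : μ Set.univ ≤ 1 := by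
  simpa using h x Set.univ

include h in
-- Contraction of oscillation: the common part `μ` contributes equally from `x` and from `y`, so
-- only the residual mass `1 - μ Set.univ` sees the oscillation `a` of `f`.
lemma lintegral_le_add_of_minorant [IsMarkovKernel κ] {f : E → ℝ≥0∞} {a : ℝ≥0∞}
    (hf : ∀ x y, f x ≤ f y + a) (x y : E) :
    ∫⁻ z, f z ∂κ x ≤ ∫⁻ z, f z ∂κ y + (1 - μ Set.univ) * a := by
  have h1 : ∫⁻ z, f z ∂residual κ μ h x ≤ (⨆ z, f z) * (1 - μ Set.univ) := by
    rw [← residual_univ h x, ← lintegral_const]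
    exact lintegral_mono fun z => le_iSup f z
  have h2 : (⨅ z, f z) * (1 - μ Set.univ) ≤ ∫⁻ z, f z ∂residual κ μ h y := by
    rw [← residual_univ h y, ← lintegral_const]
    exact lintegral_mono fun z => iInf_le f z
  have h3 : ⨆ z, f z ≤ (⨅ z, f z) + a := by
    refine iSup_le fun z => ?_
    rw [ENNReal.iInf_add]
    exact le_iInf fun w => hf z w
  rw [← residual_add h x, ← residual_add h y, lintegral_add_measure, lintegral_add_measure]
  calc _ ≤ ((⨅ z, f z) + a) * (1 - μ Set.univ) + ∫⁻ z, f z ∂μ := by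
        gcongr; exact h1.trans (by gcongr)
    _ = (⨅ z, f z) * (1 - μ Set.univ) + ∫⁻ z, f z ∂μ + (1 - μ Set.univ) * a := by ring
    _ ≤ _ := by gcongr

include h in
/-- A Markov kernel that dominates a nonzero measure has an invariant probability measure. -/
lemma exists_invariant_of_minorant [IsMarkovKernel κ] (x₀ : E) (hμ : μ Set.univ ≠ 0) :
    ∃ π : Measure E, IsProbabilityMeasure π ∧ π.bind κ = π := by
  set S := residual κ μ h
  -- The invariant measure is the series `∑ μ Sⁿ` with `S` the sub-Markov residual. Its mass is a
  -- geometric sum equal to `1`. Applying `κ = S + μ` shifts the series by one and restores the term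
  -- `n = 0`.
  set ρ : ℕ → Measure E := fun n => (fun ν : Measure E => ν.bind S)^[n] μ with hρ
  have hsucc : ∀ n, ρ (n + 1) = (ρ n).bind S := fun n => by
    simp only [hρ, Function.iterate_succ_apply']
  have hmass : ∀ n, ρ n Set.univ = μ Set.univ * (1 - μ Set.univ) ^ n := by
    intro n
    induction n with
    | zero => simp [hρ]
    | succ n ih =>
      rw [hsucc, Measure.bind_apply .univ S.aemeasurable]
      simp_rw [S, residual_univ h]
      rw [lintegral_const, ih]
      ring
  have hone : (Measure.sum ρ) Set.univ = 1 := by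
    rw [Measure.sum_apply _ .univ]
    simp_rw [hmass]
    rw [ENNReal.tsum_mul_left, ENNReal.tsum_geometric,
      ENNReal.sub_sub_cancel ENNReal.one_ne_top (minorant_univ_le_one h x₀),
      ENNReal.mul_inv_cancel hμ (measure_ne_top _ _)]
  refine ⟨Measure.sum ρ, ⟨hone⟩, ?_⟩
  ext A hA
  rw [Measure.bind_apply hA κ.aemeasurable]
  simp_rw [← residual_add h, Measure.add_apply]
  rw [lintegral_add_right _ measurable_const, lintegral_const, hone, mul_one,
    lintegral_sum_measure, Measure.sum_apply _ hA,
    tsum_eq_zero_add' (f := fun n => ρ n A) ENNReal.summable, add_comm]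
  congr 1
  refine tsum_congr fun n => ?_
  rw [hsucc, Measure.bind_apply hA S.aemeasurable]

end Doeblin

/-! ### Exponential contraction of a semigroup in total variation -/

section Semigroup

variable {E : Type*} [MeasurableSpace E] {κ : ℝ≥0 → Kernel E E} [∀ t, IsMarkovKernel (κ t)]
  (hκ : ∀ s t, κ (s + t) = κ t ∘ₖ κ s) {T : ℝ≥0} {μ : Measure E} [IsFiniteMeasure μ]
  (h : ∀ x, μ ≤ κ T x)

include hκ h in
-- Each step of length `T`, peeled off at the start, multiplies the oscillation by `1 - μ Set.univ`.
-- The remainder `r` costs nothing, since a probability oscillates by at most `1`.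
lemma semigroup_le_add_of_minorant (n : ℕ) (r : ℝ≥0) {A : Set E} (hA : MeasurableSet A) (x y : E) :
    κ (n * T + r) x A ≤ κ (n * T + r) y A + (1 - μ Set.univ) ^ n := by
  induction n generalizing x y with
  | zero => simpa using prob_le_one.trans le_add_self
  | succ n ih =>
    have : ((n + 1 : ℕ) : ℝ≥0) * T + r = T + (n * T + r) := by push_cast; ring
    rw [this, hκ, Kernel.comp_apply' _ _ _ hA, Kernel.comp_apply' _ _ _ hA, pow_succ']
    exact lintegral_le_add_of_minorant h ih x y

include hκ h in
lemma bind_semigroup_le_add_of_minorant (n : ℕ) (r : ℝ≥0) {A : Set E} (hA : MeasurableSet A)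
    (ν ν' : Measure E) [IsProbabilityMeasure ν] [IsProbabilityMeasure ν'] :
    ν.bind (κ (n * T + r)) A ≤ ν'.bind (κ (n * T + r)) A + (1 - μ Set.univ) ^ n := by
  rw [Measure.bind_apply hA (κ _).aemeasurable, Measure.bind_apply hA (κ _).aemeasurable]
  set f := fun x => κ (n * T + r) x A
  set a := (1 - μ Set.univ) ^ n
  have hf : ∀ x y, f x ≤ f y + a := semigroup_le_add_of_minorant hκ h n r hA
  calc ∫⁻ x, f x ∂ν ≤ ∫⁻ _, (∫⁻ y, f y ∂ν' + a) ∂ν := by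
        refine lintegral_mono fun x => ?_
        calc f x = ∫⁻ _, f x ∂ν' := by simp
          _ ≤ ∫⁻ y, (f y + a) ∂ν' := lintegral_mono fun y => hf x y
          _ = _ := by rw [lintegral_add_right _ measurable_const]; simp
    _ = _ := by simp

include hκ h in
lemma abs_bind_semigroup_sub_le (n : ℕ) (r : ℝ≥0) {A : Set E} (hA : MeasurableSet A)
    (ν ν' : Measure E) [IsProbabilityMeasure ν] [IsProbabilityMeasure ν'] :
    |(ν.bind (κ (n * T + r))).real A - (ν'.bind (κ (n * T + r))).real A|
      ≤ (1 - μ.real Set.univ) ^ n := by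
  have hne : Nonempty E := by
    by_contra hE
    rw [not_nonempty_iff] at hE
    simpa [Subsingleton.elim ν 0] using measure_univ (μ := ν)
  have h1 : μ Set.univ ≤ 1 := minorant_univ_le_one h hne.some
  have key : ∀ (ν ν' : Measure E) [IsProbabilityMeasure ν] [IsProbabilityMeasure ν'],
      (ν.bind (κ (n * T + r))).real A - (ν'.bind (κ (n * T + r))).real A
        ≤ (1 - μ.real Set.univ) ^ n := by
    intro ν ν' _ _
    have h0 := bind_semigroup_le_add_of_minorant hκ h n r hA ν ν'
    have h2 : (1 - μ Set.univ) ^ n ≠ ∞ := ENNReal.pow_ne_top (by simp)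
    have h3 := ENNReal.toReal_mono (ENNReal.add_ne_top.2 ⟨measure_ne_top _ _, h2⟩) h0
    rw [ENNReal.toReal_add (measure_ne_top _ _) h2, ENNReal.toReal_pow,
      ENNReal.toReal_sub_of_le h1 ENNReal.one_ne_top, ENNReal.toReal_one] at h3
    simp only [Measure.real]
    linarith
  rw [abs_sub_le_iff]
  exact ⟨key ν ν', key ν' ν⟩

include hκ h in
/-- **Doeblin's theorem** for a semigroup of Markov kernels. -/
theorem exists_invariant_exponential_of_minorant (hT : 0 < T) (x₀ : E) (hμ : μ Set.univ ≠ 0) :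
    ∃ π : Measure E, (IsProbabilityMeasure π ∧ ∀ t, π.bind (κ t) = π) ∧
      (∀ π' : Measure E, (IsProbabilityMeasure π' ∧ ∀ t, π'.bind (κ t) = π') → π' = π) ∧
      ∃ C : ℝ, 0 < C ∧ ∃ r : ℝ, 0 < r ∧ ∀ ν : Measure E, IsProbabilityMeasure ν → ∀ t : ℝ≥0,
        tvDist (ν.bind (κ t)) π ≤ C * Real.exp (-r * t) := by
  obtain ⟨π, hπ, hπT⟩ := exists_invariant_of_minorant h x₀ hμ
  have hm0 : 0 < μ.real Set.univ := ENNReal.toReal_pos hμ (measure_ne_top _ _)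
  have hm1 : μ.real Set.univ ≤ 1 := by
    simpa [Measure.real] using
      ENNReal.toReal_mono ENNReal.one_ne_top (minorant_univ_le_one h x₀)
  set m := μ.real Set.univ with hm
  have hbind : ∀ (ν : Measure E) s t, ν.bind (κ (s + t)) = (ν.bind (κ s)).bind (κ t) := by
    intro ν s t
    rw [hκ, ← Measure.comp_assoc]
  have hpow : ∀ (ν : Measure E), ν.bind (κ T) = ν → ∀ n : ℕ, ν.bind (κ ((n + 1 : ℕ) * T)) = ν := by
    intro ν hν n
    induction n with
    | zero => simpa using hν
    | succ n ih => rw [Nat.cast_succ, add_mul, one_mul, hbind, ih, hν]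
  -- Uniqueness is proved for the single kernel `κ T`, which also yields invariance under every `κ
  -- t` below.
  have huniq : ∀ ν : Measure E, IsProbabilityMeasure ν → ν.bind (κ T) = ν → ν = π := by
    intro ν hν hνT
    ext A hA
    have hle : ∀ n : ℕ, |ν.real A - π.real A| ≤ (1 - m) ^ (n + 1) := by
      intro n
      have := abs_bind_semigroup_sub_le hκ h (n + 1) 0 hA ν π
      rwa [add_zero, hpow ν hνT, hpow π hπT] at this
    have hlim : Filter.Tendsto (fun n : ℕ => (1 - m) ^ (n + 1)) Filter.atTop (nhds 0) :=
      (tendsto_pow_atTop_nhds_zero_of_lt_one (by linarith) (by linarith)).comp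
        (Filter.tendsto_add_atTop_nat 1)
    have h0 : |ν.real A - π.real A| ≤ 0 := ge_of_tendsto' hlim hle
    have h1 : ν.real A = π.real A := by
      have := abs_nonpos_iff.1 h0
      linarith
    exact (ENNReal.toReal_eq_toReal_iff' (measure_ne_top _ _) (measure_ne_top _ _)).1 h1
  -- The kernels `κ t` and `κ T` commute, so `π.bind (κ t)` is again fixed by `κ T`.
  have hinv : ∀ t, π.bind (κ t) = π := fun t => by
    refine huniq _ inferInstance ?_
    rw [← hbind, add_comm, hbind, hπT]
  refine ⟨π, ⟨hπ, hinv⟩, fun π' h' => huniq π' h'.1 (h'.2 T), ?_⟩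
  -- The natural ratio `1 - m` vanishes when `m = 1` and would have no usable logarithm; `q` lies
  -- strictly between `0` and `1`. The constant `q⁻¹` below pays for rounding `t / T` down to an
  -- integer.
  set q : ℝ := 1 - m / 2 with hq
  have hq0 : 0 < q := by linarith
  have hq1 : q < 1 := by linarith
  have hT' : (0 : ℝ) < T := hT
  have hlog : Real.log q < 0 := Real.log_neg hq0 hq1
  refine ⟨q⁻¹, inv_pos.2 hq0, -Real.log q / T, div_pos (by linarith) hT', fun ν hν t => ?_⟩
  set n := ⌊t / T⌋₊ with hn
  have hnT : (n : ℝ≥0) * T ≤ t := by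
    have := Nat.floor_le (zero_le (a := t / T))
    calc (n : ℝ≥0) * T ≤ t / T * T := by gcongr
      _ = t := div_mul_cancel₀ _ hT.ne'
  have ht : (n : ℝ≥0) * T + (t - n * T) = t := add_tsub_cancel_of_le hnT
  have hlt : (t : ℝ) / T < n + 1 := by
    have := Nat.lt_floor_add_one (t / T)
    exact_mod_cast this
  have hexp : (1 - m) ^ n ≤ q⁻¹ * Real.exp (-(-Real.log q / T) * t) := by
    have e1 : (1 - m) ^ n ≤ q ^ n := pow_le_pow_left₀ (by linarith) (by linarith) n
    refine e1.trans ?_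
    have e2 : q ^ n = q⁻¹ * Real.exp ((n + 1) * Real.log q) := by
      rw [add_mul, one_mul, Real.exp_add, Real.exp_log hq0, Real.exp_nat_mul, Real.exp_log hq0]
      field_simp
    rw [e2]
    refine mul_le_mul_of_nonneg_left (Real.exp_le_exp.2 ?_) (inv_nonneg.2 hq0.le)
    calc ((n : ℝ) + 1) * Real.log q ≤ (t / T) * Real.log q :=
          mul_le_mul_of_nonpos_right hlt.le hlog.le
      _ = _ := by ring
  unfold tvDist
  have : Nonempty {A : Set E // MeasurableSet A} := ⟨⟨∅, .empty⟩⟩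
  refine ciSup_le fun A => ?_
  have := abs_bind_semigroup_sub_le hκ h n (t - n * T) A.2 ν π
  rw [ht, hinv] at this
  exact this.trans hexp

end Semigroup

/-! ### The Chapman–Kolmogorov equation for a well-posed diffusion -/

section Regularity

variable {d n : ℕ}

/-- The covering map `ℝ ^ d → 𝕋 ^ d`. -/
def torusProj (y : Fin d → ℝ) : Torus d := fun k => (y k : UnitAddCircle)

lemma isOpenQuotientMap_torusProj : IsOpenQuotientMap (torusProj (d := d)) :=
  IsOpenQuotientMap.piMap fun _ => QuotientAddGroup.isOpenQuotientMap_mk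

lemma partialDeriv_torusProj {f : Torus d → ℝ} (hf : Differentiable ℝ fun y => f (torusProj y))
    (k : Fin d) (y : Fin d → ℝ) :
    partialDeriv k f (torusProj y) = fderiv ℝ (fun y => f (torusProj y)) y (Pi.single k 1) := by
  have h1 : (fun s : ℝ => f (torusProj y + Pi.single k (s : UnitAddCircle))) =
      fun s : ℝ => f (torusProj (y + s • Pi.single k (1 : ℝ))) := by
    funext s
    congr 1
    funext l
    rcases eq_or_ne l k with rfl | hl
    · simp [torusProj]
    · simp [torusProj, hl]
  unfold partialDeriv
  rw [h1]
  have h2 : HasDerivAt (fun s : ℝ => y + s • Pi.single k (1 : ℝ)) (Pi.single k 1) 0 := by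
    simpa using ((hasDerivAt_id (0 : ℝ)).smul_const (Pi.single k (1 : ℝ) : Fin d → ℝ)).const_add y
  have h3 := (hf (y + (0 : ℝ) • Pi.single k (1 : ℝ))).hasFDerivAt.comp_hasDerivAt (0 : ℝ) h2
  rw [zero_smul, add_zero] at h3
  exact h3.deriv

lemma contDiff_partialDeriv {f : Torus d → ℝ} {p : ℕ}
    (hf : ContDiff ℝ (p + 1) fun y => f (torusProj y)) (k : Fin d) :
    ContDiff ℝ p fun y => partialDeriv k f (torusProj y) := by
  have h : Differentiable ℝ fun y => f (torusProj y) := hf.differentiable (by simp)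
  simp_rw [partialDeriv_torusProj h]
  exact (hf.fderiv_right le_rfl).clm_apply contDiff_const

lemma measurable_of_continuous_torusProj {g : Torus d → ℝ}
    (hg : Continuous fun y => g (torusProj y)) : Measurable g :=
  (isOpenQuotientMap_torusProj.isQuotientMap.continuous_iff.2 hg).measurable

/-- The partial derivatives of order at most two lift to continuous functions on `ℝ ^ d`, hence are
continuous on the quotient. The measurability obtained here is what Tonelli needs for the time
integrals along paths. -/
lemma measurable_generator {b : Torus d → Fin d → ℝ} {σ : Torus d → Matrix (Fin d) (Fin n) ℝ}
    (hb : Measurable b) (hσ : ∀ k l, Measurable fun x => σ x k l) {f : Torus d → ℝ} (hf : IsC2 f) :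
    Measurable (generator b σ f) := by
  have h2 : ContDiff ℝ ((1 : ℕ) + 1) fun y => f (torusProj y) := by
    norm_num
    exact hf
  have h1 : ∀ k, ContDiff ℝ ((0 : ℕ) + 1) fun y => partialDeriv k f (torusProj y) := fun k => by
    simpa using contDiff_partialDeriv h2 k
  have m1 : ∀ k, Measurable (partialDeriv k f) := fun k =>
    measurable_of_continuous_torusProj (h1 k).continuous
  have m2 : ∀ k l, Measurable (partialDeriv k (partialDeriv l f)) := fun k l =>
    measurable_of_continuous_torusProj (contDiff_partialDeriv (h1 l) k).continuous
  have m3 : ∀ k, Measurable fun x => b x k := fun k => (measurable_pi_apply k).comp hb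
  unfold generator
  simp only [Matrix.mul_apply, Matrix.transpose_apply]
  fun_prop

end Regularity

/-! ### The Markov property of a diffusion, from uniqueness in law -/

section Shift

variable {d n : ℕ}

/-- The path seen from time `s` on. -/
def Path.shift (s : ℝ≥0) (ω : Path d) : Path d :=
  ⟨fun t => ω.1 (t + s), ω.2.comp (continuous_id.add continuous_const)⟩

@[simp]
lemma Path.eval_shift (s t : ℝ≥0) (ω : Path d) : (ω.shift s).eval t = ω.eval (t + s) := rfl

lemma Path.measurable_shift (s : ℝ≥0) : Measurable (Path.shift (d := d) s) :=
  Measurable.subtype_mk (measurable_pi_lambda _ fun t => Path.measurable_eval (t + s))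

lemma Path.measurable_shift_canonicalFiltration (s t : ℝ≥0) :
    Measurable[canonicalFiltration d (t + s), canonicalFiltration d t] (Path.shift (d := d) s) := by
  rw [measurable_iff_comap_le]
  simp only [canonicalFiltration, Filtration.natural, MeasurableSpace.comap_iSup]
  refine iSup₂_le fun j hj => ?_
  rw [MeasurableSpace.comap_comp]
  exact le_iSup₂_of_le (f := fun j (_ : j ≤ t + s) => MeasurableSpace.comap (Path.eval j) _)
    (j + s) (add_le_add_left hj s) le_rfl

variable {b : Torus d → Fin d → ℝ} {σ : Torus d → Matrix (Fin d) (Fin n) ℝ}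

lemma measurable_generator_path (hb : Measurable b) (hσ : ∀ k l, Measurable fun x => σ x k l)
    {f : Torus d → ℝ} (hf : IsC2 f) :
    Measurable fun p : Path d × ℝ => generator b σ f (p.1.eval p.2.toNNReal) :=
  (measurable_generator hb hσ hf).comp
    (Path.measurable_uncurry_eval.comp (measurable_snd.real_toNNReal.prodMk measurable_fst))

/-- Off this event the time integral in `martingaleProcess` takes the default value `0` and need not
be additive, so `martingaleProcess_shift` holds only almost surely. -/
lemma IsSolution.ae_integrableOn (hb : Measurable b) (hσ : ∀ k l, Measurable fun x => σ x k l)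
    {ν : Measure (Torus d)} {R : Measure (Path d)} (hR : IsSolution b σ ν R)
    {f : Torus d → ℝ} (hf : IsC2 f) (t : ℝ≥0) :
    ∀ᵐ ω ∂ R, IntegrableOn (fun r : ℝ => generator b σ f (ω.eval r.toNNReal))
      (Set.Icc (0 : ℝ) t) := by
  have hm := measurable_generator_path hb hσ hf
  have h := ae_lt_top (hm.enorm.lintegral_prod_right' (ν := volume.restrict (Set.Icc (0 : ℝ) t)))
    (hR.integrable f hf t).ne
  filter_upwards [h] with ω hω
  exact ⟨(hm.comp measurable_prodMk_left).aestronglyMeasurable, hω⟩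

lemma martingaleProcess_shift {f : Torus d → ℝ} (s t : ℝ≥0) {ω : Path d}
    (hω : IntegrableOn (fun r : ℝ => generator b σ f (ω.eval r.toNNReal))
      (Set.Icc (0 : ℝ) (t + s : ℝ≥0))) :
    martingaleProcess b σ f t (ω.shift s) =
      martingaleProcess b σ f (t + s) ω - martingaleProcess b σ f s ω := by
  set G := fun r : ℝ => generator b σ f (ω.eval r.toNNReal) with hG
  have h1 : ∫ r in (0 : ℝ)..t, generator b σ f ((ω.shift s).eval r.toNNReal) =
      ∫ r in (0 : ℝ)..t, G (r + s) := by
    refine intervalIntegral.integral_congr fun r hr => ?_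
    rw [Set.uIcc_of_le t.coe_nonneg] at hr
    simp only [Path.eval_shift, hG]
    rw [Real.toNNReal_add hr.1 s.coe_nonneg, Real.toNNReal_coe]
  have h2 : ∫ r in (0 : ℝ)..t, G (r + s) = ∫ r in (s : ℝ)..(t + s : ℝ≥0), G r := by
    rw [intervalIntegral.integral_comp_add_right]
    simp
  have hle : (s : ℝ) ≤ (t + s : ℝ≥0) := by simp
  have i1 : IntervalIntegrable G volume 0 (t + s : ℝ≥0) :=
    (intervalIntegrable_iff_integrableOn_Icc_of_le (t + s).coe_nonneg).2 hω
  have i2 : IntervalIntegrable G volume 0 s :=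
    (intervalIntegrable_iff_integrableOn_Icc_of_le s.coe_nonneg).2
      (hω.mono_set (Set.Icc_subset_Icc_right hle))
  have h3 := intervalIntegral.integral_interval_sub_left i1 i2
  simp only [martingaleProcess]
  rw [h1, h2, ← h3]
  simp only [Path.eval_shift, zero_add, hG]
  ring

/-- Along the shifted path `M^f_t` becomes the increment `M^f_{t+s} - M^f_s`. An event of the
shifted past up to `i` pulls back to one of the past up to `i + s`, so the martingale property
transfers and the terms at time `s` cancel. -/
lemma IsSolution.shift (hb : Measurable b) (hσ : ∀ k l, Measurable fun x => σ x k l)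
    {ν : Measure (Torus d)} {R : Measure (Path d)} [IsProbabilityMeasure R]
    (hR : IsSolution b σ ν R) (s : ℝ≥0) :
    IsSolution b σ (R.map (Path.eval s)) (R.map (Path.shift s)) := by
  have hs := Path.measurable_shift (d := d) s
  have hprob : IsProbabilityMeasure (R.map (Path.shift s)) :=
    Measure.isProbabilityMeasure_map hs.aemeasurable
  refine ⟨?_, fun f hf t => ?_, fun f hf => ⟨(hR.martingale f hf).1, fun i j hij => ?_⟩⟩
  · rw [Measure.map_map (Path.measurable_eval 0) hs]
    congr 1
    funext ω
    simp
  · have hm := measurable_generator_path hb hσ hf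
    rw [lintegral_map
      (hm.enorm.lintegral_prod_right' (ν := volume.restrict (Set.Icc (0 : ℝ) t))) hs]
    refine lt_of_le_of_lt (lintegral_mono fun ω => ?_) (hR.integrable f hf (t + s))
    set G := fun r : ℝ => ‖generator b σ f (ω.eval r.toNNReal)‖ₑ with hG
    have hGm : Measurable G := (hm.comp measurable_prodMk_left).enorm
    calc ∫⁻ r in Set.Icc (0 : ℝ) t, ‖generator b σ f ((ω.shift s).eval r.toNNReal)‖ₑ
        = ∫⁻ r in Set.Icc (0 : ℝ) t, G (r + s) := by
          refine setLIntegral_congr_fun measurableSet_Icc fun r hr => ?_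
          simp only [Path.eval_shift, hG]
          rw [Real.toNNReal_add hr.1 s.coe_nonneg, Real.toNNReal_coe]
      _ = ∫⁻ r in (fun r => r + (s : ℝ)) ⁻¹' Set.Icc (s : ℝ) (t + s), G (r + s) := by simp
      _ = ∫⁻ r in Set.Icc (s : ℝ) (t + s), G r :=
          (measurePreserving_add_right volume (s : ℝ)).setLIntegral_comp_preimage
            measurableSet_Icc hGm
      _ ≤ ∫⁻ r in Set.Icc (0 : ℝ) (t + s : ℝ≥0), G r :=
          lintegral_mono_set (by
            rw [NNReal.coe_add]
            exact Set.Icc_subset_Icc_left s.coe_nonneg)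
  · have hM := hR.martingale f hf
    have hae : ∀ t : ℝ≥0, ∀ᵐ ω ∂ R, martingaleProcess b σ f t (ω.shift s) =
        martingaleProcess b σ f (t + s) ω - martingaleProcess b σ f s ω := fun t => by
      filter_upwards [hR.ae_integrableOn hb hσ hf (t + s)] with ω hω
      exact martingaleProcess_shift s t hω
    have hsm : ∀ t, StronglyMeasurable (martingaleProcess b σ f t) := fun t =>
      (hM.1 t).mono ((canonicalFiltration d).le t)
    have hint : ∀ t, Integrable (martingaleProcess b σ f t) (R.map (Path.shift s)) := fun t => by
      rw [integrable_map_measure (hsm t).aestronglyMeasurable hs.aemeasurable]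
      exact ((hM.integrable (t + s)).sub (hM.integrable s)).congr
        ((hae t).mono fun ω hω => hω.symm)
    refine (ae_eq_condExp_of_forall_setIntegral_eq ((canonicalFiltration d).le i) (hint j)
      (fun A _ _ => (hint i).integrableOn) (fun A hA _ => ?_)
      (hM.1 i).aestronglyMeasurable).symm
    have hA' := (canonicalFiltration d).le i A hA
    have hpre := Path.measurable_shift_canonicalFiltration s i hA
    have key : ∀ t, ∫ ω in A, martingaleProcess b σ f t ω ∂(R.map (Path.shift s)) =
        ∫ ω in Path.shift s ⁻¹' A, martingaleProcess b σ f (t + s) ω ∂ R -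
          ∫ ω in Path.shift s ⁻¹' A, martingaleProcess b σ f s ω ∂ R := fun t => by
      rw [setIntegral_map hA' (hsm t).aestronglyMeasurable hs.aemeasurable,
        ← integral_sub (hM.integrable (t + s)).integrableOn (hM.integrable s).integrableOn]
      exact integral_congr_ae (ae_restrict_of_ae (hae t))
    rw [key, key, hM.setIntegral_eq (add_le_add_left hij s) hpre]

/-- Uniqueness is applied to the initial law of `X_s`, which is in general not a point mass: the
shifted path then has the mixture law, and its marginal at `t` is the composition. -/
lemma IsDiffusion.semigroup_add (hb : Measurable b) (hσ : ∀ k l, Measurable fun x => σ x k l)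
    {P : Kernel (Torus d) (Path d)} [IsMarkovKernel P] (hP : IsDiffusion b σ P) (s t : ℝ≥0) :
    semigroup P (s + t) = semigroup P t ∘ₖ semigroup P s := by
  ext x : 1
  have h0 := hP.exists_solution (Measure.dirac x) inferInstance
  rw [Measure.dirac_bind P.measurable] at h0
  have hprob : IsProbabilityMeasure ((P x).map (Path.eval s)) :=
    Measure.isProbabilityMeasure_map (Path.measurable_eval s).aemeasurable
  have hprob' : IsProbabilityMeasure ((P x).map (Path.shift s)) :=
    Measure.isProbabilityMeasure_map (Path.measurable_shift s).aemeasurable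
  have h1 := hP.unique_solution _ hprob _ hprob' (h0.shift hb hσ s)
  have h2 := congrArg (Measure.map (Path.eval t)) h1
  rw [Measure.map_map (Path.measurable_eval t) (Path.measurable_shift s),
    Measure.map_comp _ _ (Path.measurable_eval t)] at h2
  rw [Kernel.comp_apply, semigroup, semigroup, semigroup,
    Kernel.map_apply _ (Path.measurable_eval _), Kernel.map_apply _ (Path.measurable_eval _), ← h2]
  congr 1
  funext ω
  simp [add_comm]

end Shift

/-! ### Holding times -/

namespace RateMatrix

variable {m : ℕ} (Q : RateMatrix m)

lemma lintegral_holdingLaw_of_pos {i : Fin m} (h : 0 < Q.exitRate i) {F : ℝ≥0∞ → ℝ≥0∞}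
    (hF : Measurable F) :
    ∫⁻ τ, F τ ∂Q.holdingLaw i =
      ∫⁻ r : ℝ, exponentialPDF (Q.exitRate i) r * F (ENNReal.ofReal r) := by
  rw [holdingLaw, if_pos h, lintegral_map hF ENNReal.measurable_ofReal]
  have hpdf : Measurable (exponentialPDF (Q.exitRate i)) :=
    (measurable_exponentialPDFReal _).ennreal_ofReal
  exact lintegral_withDensity_eq_lintegral_mul _ hpdf (hF.comp ENNReal.measurable_ofReal)

lemma lintegral_holdingLaw_sub_of_pos {i : Fin m} (h : 0 < Q.exitRate i) (t : ℝ≥0)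
    {F : ℝ≥0∞ → ℝ≥0∞} (hF : Measurable F) :
    ∫⁻ τ, (if (t : ℝ≥0∞) < τ then F (τ - t) else 0) ∂Q.holdingLaw i =
      ENNReal.ofReal (Real.exp (-(Q.exitRate i * t))) * ∫⁻ τ, F τ ∂Q.holdingLaw i := by
  have hG : Measurable fun τ : ℝ≥0∞ => if (t : ℝ≥0∞) < τ then F (τ - t) else 0 :=
    Measurable.ite measurableSet_Ioi (hF.comp (measurable_id.sub_const _)) measurable_const
  have hpdf : Measurable (exponentialPDF (Q.exitRate i)) :=
    (measurable_exponentialPDFReal _).ennreal_ofReal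
  rw [Q.lintegral_holdingLaw_of_pos h hF, Q.lintegral_holdingLaw_of_pos h hG,
    ← lintegral_const_mul _ (show Measurable fun r : ℝ =>
      exponentialPDF (Q.exitRate i) r * F (ENNReal.ofReal r) from
        hpdf.mul (hF.comp ENNReal.measurable_ofReal)),
    ← lintegral_add_right_eq_self _ (t : ℝ)]
  -- At `r = 0` the strict inequality kills the left side while the exponential density is positive;
  -- this single point is negligible.
  have h0 : ∀ᵐ r : ℝ, r ≠ 0 := by simp [ae_iff]
  refine lintegral_congr_ae ?_
  filter_upwards [h0] with r hr
  have ht : (t : ℝ≥0∞) = ENNReal.ofReal t := by simp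
  rcases lt_or_gt_of_ne hr with hr | hr
  · have : ¬ (t : ℝ≥0∞) < ENNReal.ofReal (r + t) := by
      rw [not_lt, ht]
      exact ENNReal.ofReal_le_ofReal (by linarith)
    rw [if_neg this, exponentialPDF_of_neg hr]
    simp
  · have : (t : ℝ≥0∞) < ENNReal.ofReal (r + t) := by
      rw [ht]
      exact (ENNReal.ofReal_lt_ofReal_iff_of_nonneg t.coe_nonneg).2 (by linarith)
    have e1 : ENNReal.ofReal (r + t) - t = ENNReal.ofReal r := by
      rw [ht, ← ENNReal.ofReal_sub _ t.coe_nonneg, add_sub_cancel_right]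
    have hrt : 0 ≤ r + t := add_nonneg hr.le t.coe_nonneg
    rw [if_pos this, e1, exponentialPDF_of_nonneg hr.le, exponentialPDF_of_nonneg hrt, ← mul_assoc,
      ← ENNReal.ofReal_mul (Real.exp_pos _).le]
    congr 2
    rw [mul_add, neg_add, Real.exp_add]
    ring

lemma holdingLaw_Ioi_of_pos {i : Fin m} (h : 0 < Q.exitRate i) (t : ℝ≥0) :
    Q.holdingLaw i (Set.Ioi (t : ℝ≥0∞)) = ENNReal.ofReal (Real.exp (-(Q.exitRate i * t))) := by
  have := Q.lintegral_holdingLaw_sub_of_pos h t (F := fun _ => 1) measurable_const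
  rw [lintegral_const, measure_univ, mul_one, mul_one] at this
  rw [← this, ← lintegral_indicator_one measurableSet_Ioi]
  refine lintegral_congr fun τ => ?_
  simp [Set.indicator_apply]

lemma holdingLaw_of_not_pos {i : Fin m} (h : ¬ 0 < Q.exitRate i) :
    Q.holdingLaw i = Measure.dirac ∞ := if_neg h

/-- The holding times have no memory. -/
lemma lintegral_holdingLaw_sub (i : Fin m) (t : ℝ≥0) {F : ℝ≥0∞ → ℝ≥0∞} (hF : Measurable F) :
    ∫⁻ τ, (if (t : ℝ≥0∞) < τ then F (τ - t) else 0) ∂Q.holdingLaw i =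
      Q.holdingLaw i (Set.Ioi (t : ℝ≥0∞)) * ∫⁻ τ, F τ ∂Q.holdingLaw i := by
  by_cases h : 0 < Q.exitRate i
  · rw [Q.holdingLaw_Ioi_of_pos h, Q.lintegral_holdingLaw_sub_of_pos h t hF]
  · simp [Q.holdingLaw_of_not_pos h]

lemma holdingLaw_Ioi_add (i : Fin m) (s t : ℝ≥0) :
    Q.holdingLaw i (Set.Ioi ((s + t : ℝ≥0) : ℝ≥0∞)) =
      Q.holdingLaw i (Set.Ioi (s : ℝ≥0∞)) * Q.holdingLaw i (Set.Ioi (t : ℝ≥0∞)) := by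
  by_cases h : 0 < Q.exitRate i
  · rw [Q.holdingLaw_Ioi_of_pos h, Q.holdingLaw_Ioi_of_pos h, Q.holdingLaw_Ioi_of_pos h,
      ← ENNReal.ofReal_mul (Real.exp_pos _).le, ← Real.exp_add]
    congr 2
    push_cast
    ring
  · simp [Q.holdingLaw_of_not_pos h]

lemma holdingLaw_Ioi_pos (i : Fin m) (t : ℝ≥0) : 0 < Q.holdingLaw i (Set.Ioi (t : ℝ≥0∞)) := by
  by_cases h : 0 < Q.exitRate i
  · rw [Q.holdingLaw_Ioi_of_pos h]
    exact ENNReal.ofReal_pos.2 (Real.exp_pos _)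
  · simp [Q.holdingLaw_of_not_pos h]

lemma holdingLaw_Iic_pos {i : Fin m} (h : 0 < Q.exitRate i) {t : ℝ≥0} (ht : 0 < t) :
    0 < Q.holdingLaw i (Set.Iic (t : ℝ≥0∞)) := by
  rw [← Set.compl_Ioi, prob_compl_eq_one_sub measurableSet_Ioi, Q.holdingLaw_Ioi_of_pos h,
    tsub_pos_iff_lt, ENNReal.ofReal_lt_one, Real.exp_lt_one_iff, neg_lt_zero]
  exact mul_pos h ht

lemma ae_holdingLaw_pos (i : Fin m) : ∀ᵐ τ ∂Q.holdingLaw i, 0 < τ := by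
  by_cases h : 0 < Q.exitRate i
  · refine (mem_ae_iff_prob_eq_one measurableSet_Ioi).2 ?_
    have := Q.holdingLaw_Ioi_of_pos h 0
    simpa using this
  · simp [Q.holdingLaw_of_not_pos h]

/-- The function `e ^ (-τ)` on `[0, ∞]`. -/
def expNeg (τ : ℝ≥0∞) : ℝ≥0∞ := EReal.exp (-(τ : EReal))

lemma measurable_expNeg : Measurable expNeg :=
  EReal.measurable_exp.comp (measurable_coe_ennreal_ereal.neg)

lemma expNeg_add (σ τ : ℝ≥0∞) : expNeg (σ + τ) = expNeg σ * expNeg τ := by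
  unfold expNeg
  rw [← EReal.exp_add, EReal.coe_ennreal_add, EReal.neg_add, sub_eq_add_neg]
  · exact Or.inl (EReal.coe_ennreal_ne_bot _)
  · exact Or.inr (EReal.coe_ennreal_ne_bot _)

lemma expNeg_zero : expNeg 0 = 1 := by simp [expNeg]

lemma expNeg_antitone : Antitone expNeg := fun σ τ h => by
  unfold expNeg
  exact EReal.exp_monotone (EReal.neg_le_neg_iff.2 (EReal.coe_ennreal_le_coe_ennreal_iff.2 h))

lemma expNeg_coe_pos (t : ℝ≥0) : 0 < expNeg t := by
  unfold expNeg
  rw [← EReal.exp_bot]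
  refine EReal.exp_strictMono (bot_lt_iff_ne_bot.2 ?_)
  simp

lemma expNeg_lt_one {τ : ℝ≥0∞} (h : 0 < τ) : expNeg τ < 1 := by
  unfold expNeg
  rw [← EReal.exp_zero]
  refine EReal.exp_strictMono ?_
  rw [EReal.neg_lt_comm, neg_zero]
  exact_mod_cast h

lemma lintegral_expNeg_holdingLaw_lt_one (i : Fin m) : ∫⁻ τ, expNeg τ ∂Q.holdingLaw i < 1 := by
  have h1 : ∫⁻ _, (1 : ℝ≥0∞) ∂Q.holdingLaw i = 1 := by simp
  have hle : expNeg ≤ᵐ[Q.holdingLaw i] fun _ => 1 :=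
    (Q.ae_holdingLaw_pos i).mono fun τ h => (expNeg_lt_one h).le
  have hfin : ∫⁻ τ, expNeg τ ∂Q.holdingLaw i ≠ ∞ :=
    ((lintegral_mono_ae hle).trans_lt (by rw [h1]; exact ENNReal.one_lt_top)).ne
  rw [← h1]
  exact lintegral_strict_mono (NeZero.ne _) aemeasurable_const hfin
    ((Q.ae_holdingLaw_pos i).mono fun τ h => expNeg_lt_one h)

/-- Holding times are almost surely positive, so each mean is below `1`; finiteness of the set of
modes makes the bound uniform. This `ρ` drives the proof of nonexplosion. -/
lemma exists_lintegral_expNeg_holdingLaw_le :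
    ∃ ρ < (1 : ℝ≥0∞), ∀ i, ∫⁻ τ, expNeg τ ∂Q.holdingLaw i ≤ ρ :=
  ⟨Finset.univ.sup fun i => ∫⁻ τ, expNeg τ ∂Q.holdingLaw i,
    (Finset.sup_lt_iff (by simp)).2 fun i _ => Q.lintegral_expNeg_holdingLaw_lt_one i,
    fun i => Finset.le_sup (f := fun i => ∫⁻ τ, expNeg τ ∂Q.holdingLaw i) (Finset.mem_univ i)⟩

lemma exitRate_eq_sum (i : Fin m) : ∑ j ∈ Finset.univ.erase i, Q.rate i j = Q.exitRate i := by
  have := Finset.add_sum_erase Finset.univ (Q.rate i) (Finset.mem_univ i)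
  rw [Q.row_sum i] at this
  unfold exitRate
  linarith

lemma exitRate_pos {i j : Fin m} (hij : i ≠ j) (h : 0 < Q.rate i j) : 0 < Q.exitRate i := by
  rw [← Q.exitRate_eq_sum i]
  exact Finset.sum_pos' (fun k hk => Q.rate_nonneg i k (Finset.ne_of_mem_erase hk).symm)
    ⟨j, Finset.mem_erase.2 ⟨hij.symm, Finset.mem_univ j⟩, h⟩

lemma jumpLaw_singleton_pos {i j : Fin m} (hij : i ≠ j) (h : 0 < Q.rate i j) :
    0 < Q.jumpLaw i {j} := by
  have hi := Q.exitRate_pos hij h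
  rw [jumpLaw, if_pos hi, Measure.coe_finsetSum, Finset.sum_apply]
  refine lt_of_lt_of_le (ENNReal.ofReal_pos.2 (div_pos h hi)) ?_
  refine le_trans ?_ (Finset.single_le_sum (fun _ _ => zero_le)
    (Finset.mem_erase.2 ⟨hij.symm, Finset.mem_univ j⟩))
  simp

end RateMatrix

/-! ### The switched process on the event of a given number of jumps -/

section Kernels

variable {d m : ℕ} (Q : RateMatrix m) (P : Fin m → Kernel (Torus d) (Path d))
  [∀ i, IsMarkovKernel (P i)]

instance (P : Kernel (Torus d) (Path d)) [IsMarkovKernel P] (t : ℝ≥0) :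
    IsMarkovKernel (semigroup P t) :=
  Kernel.IsMarkovKernel.map _ (Path.measurable_eval t)

lemma lintegral_semigroup (P : Kernel (Torus d) (Path d)) (t : ℝ≥0) (x : Torus d)
    {g : Torus d → ℝ≥0∞} (hg : Measurable g) :
    ∫⁻ y, g y ∂semigroup P t x = ∫⁻ ω, g (ω.eval t) ∂P x := by
  rw [semigroup, Kernel.map_apply _ (Path.measurable_eval t),
    lintegral_map hg (Path.measurable_eval t)]

/-- Joint measurability in time and position comes from integrating over whole paths, because
evaluation is jointly measurable in time and path. -/
lemma measurable_lintegral_semigroup (P : Kernel (Torus d) (Path d)) [IsMarkovKernel P]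
    {α : Type*} [MeasurableSpace α] {G : α × Torus d → ℝ≥0∞} (hG : Measurable G)
    {t : α → ℝ≥0} (ht : Measurable t) {x : α → Torus d} (hx : Measurable x) :
    Measurable fun a => ∫⁻ y, G (a, y) ∂semigroup P (t a) (x a) := by
  have h : ∀ a, ∫⁻ y, G (a, y) ∂semigroup P (t a) (x a) =
      ∫⁻ ω, G (a, ω.eval (t a)) ∂(P.comap x hx) a := fun a =>
    lintegral_semigroup P (t a) (x a) (hG.comp measurable_prodMk_left)
  simp_rw [h]
  refine Measurable.lintegral_kernel_prod_right' (κ := P.comap x hx)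
    (f := fun p : α × Path d => G (p.1, p.2.eval (t p.1))) (hG.comp ?_)
  exact measurable_fst.prodMk
    (Path.measurable_uncurry_eval.comp ((ht.comp measurable_fst).prodMk measurable_snd))

lemma lintegral_stageKernel (z : State d m) {F : Stage d m → ℝ≥0∞} (hF : Measurable F) :
    ∫⁻ s, F s ∂stageKernel Q P z = ∫⁻ τ, ∫⁻ ω, F (ω, τ, z.2) ∂P z.2 z.1 ∂Q.holdingLaw z.2 := by
  have h1 : stageKernel Q P z =
      (P z.2 z.1).prod ((Q.holdingLaw z.2).prod (Measure.dirac z.2)) := by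
    rw [stageKernel, Kernel.prod_apply, Kernel.prod_apply]
    rfl
  rw [h1, lintegral_prod_symm _ hF.aemeasurable,
    lintegral_prod _ (hF.lintegral_prod_left').aemeasurable]
  refine lintegral_congr fun τ => ?_
  exact lintegral_dirac' _ (hF.lintegral_prod_left'.comp measurable_prodMk_left)

lemma lintegral_jumpStateKernel (s : Stage d m) {g : State d m → ℝ≥0∞} (hg : Measurable g) :
    ∫⁻ z, g z ∂jumpStateKernel Q s = ∫⁻ j, g (s.endpoint, j) ∂Q.jumpLaw s.2.2 := by
  have h1 : jumpStateKernel Q s = (Measure.dirac s.endpoint).prod (Q.jumpLaw s.2.2) := by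
    rw [jumpStateKernel, Kernel.prod_apply]
    rfl
  rw [h1, lintegral_prod _ hg.aemeasurable, lintegral_dirac' _ hg.lintegral_prod_right']

/-- The law of the next stage given the present one. -/
def stepKernel : Kernel (Stage d m) (Stage d m) := stageKernel Q P ∘ₖ jumpStateKernel Q

instance : IsMarkovKernel (stepKernel Q P) := by
  unfold stepKernel; infer_instance

omit [∀ i, IsMarkovKernel (P i)] in
lemma lintegral_stepKernel (s : Stage d m) {F : Stage d m → ℝ≥0∞} (hF : Measurable F) :
    ∫⁻ s', F s' ∂stepKernel Q P s =
      ∫⁻ j, ∫⁻ s', F s' ∂stageKernel Q P (s.endpoint, j) ∂Q.jumpLaw s.2.2 := by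
  rw [stepKernel, Kernel.lintegral_comp _ _ _ hF, lintegral_jumpStateKernel _ _ hF.lintegral_kernel]

end Kernels

section Expectation

variable {d m : ℕ} (Q : RateMatrix m) (P : Fin m → Kernel (Torus d) (Path d))
  [∀ i, IsMarkovKernel (P i)]

/-- The expectation of `f (X_t, I_t)` on the event that there are exactly `n` jumps before `t`,
as a function of the first stage. -/
def stageExpect (f : State d m → ℝ≥0∞) : ℕ → ℝ≥0 → Stage d m → ℝ≥0∞
  -- A jump exactly at time `t` counts as having occurred, in agreement with `jumpCount`.
  | 0, t, s => if (t : ℝ≥0∞) < s.2.1 then f (s.1.eval t, s.2.2) else 0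
  | n + 1, t, s => if s.2.1 ≤ (t : ℝ≥0∞) then
      ∫⁻ s', stageExpect f n (t - s.2.1.toNNReal) s' ∂stepKernel Q P s else 0

/-- The expectation of `f (X_t, I_t)` on the event that there are exactly `n` jumps before `t`,
as a function of the initial state. -/
def stateExpect (f : State d m → ℝ≥0∞) (n : ℕ) (t : ℝ≥0) (z : State d m) : ℝ≥0∞ :=
  ∫⁻ s, stageExpect Q P f n t s ∂stageKernel Q P z

variable {f : State d m → ℝ≥0∞} (hf : Measurable f)
include hf

lemma measurable_stageExpect_comp (n : ℕ) {α : Type*} [MeasurableSpace α] {t : α → ℝ≥0}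
    (ht : Measurable t) {s : α → Stage d m} (hs : Measurable s) :
    Measurable fun a => stageExpect Q P f n (t a) (s a) := by
  induction n generalizing α with
  | zero =>
    refine Measurable.ite (measurableSet_lt ht.coe_nnreal_ennreal hs.snd.fst) (hf.comp ?_)
      measurable_const
    exact (Path.measurable_uncurry_eval.comp (ht.prodMk hs.fst)).prodMk hs.snd.snd
  | succ n ih =>
    refine Measurable.ite (measurableSet_le hs.snd.fst ht.coe_nnreal_ennreal) ?_ measurable_const
    exact Measurable.lintegral_kernel_prod_right' (κ := (stepKernel Q P).comap s hs)
      (f := fun q : α × Stage d m => stageExpect Q P f n (t q.1 - (s q.1).2.1.toNNReal) q.2)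
      (ih ((ht.comp measurable_fst).sub (hs.comp measurable_fst).snd.fst.ennreal_toNNReal)
        measurable_snd)

lemma measurable_stageExpect (n : ℕ) (t : ℝ≥0) : Measurable (stageExpect Q P f n t) :=
  measurable_stageExpect_comp Q P hf n measurable_const measurable_id

lemma measurable_stateExpect_comp (n : ℕ) {α : Type*} [MeasurableSpace α] {t : α → ℝ≥0}
    (ht : Measurable t) {z : α → State d m} (hz : Measurable z) :
    Measurable fun a => stateExpect Q P f n (t a) (z a) :=
  Measurable.lintegral_kernel_prod_right' (κ := (stageKernel Q P).comap z hz)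
    (f := fun q : α × Stage d m => stageExpect Q P f n (t q.1) q.2)
    (measurable_stageExpect_comp Q P hf n (ht.comp measurable_fst) measurable_snd)

lemma measurable_stateExpect (n : ℕ) (t : ℝ≥0) : Measurable (stateExpect Q P f n t) :=
  measurable_stateExpect_comp Q P hf n measurable_const measurable_id

lemma measurable_lintegral_jumpLaw_stateExpect (n : ℕ) (i : Fin m) {α : Type*} [MeasurableSpace α]
    {t : α → ℝ≥0} (ht : Measurable t) {x : α → Torus d} (hx : Measurable x) :
    Measurable fun a => ∫⁻ j, stateExpect Q P f n (t a) (x a, j) ∂Q.jumpLaw i :=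
  Measurable.lintegral_prod_right'
    (f := fun q : α × Fin m => stateExpect Q P f n (t q.1) (x q.1, q.2))
    (measurable_stateExpect_comp Q P hf n (ht.comp measurable_fst)
      ((hx.comp measurable_fst).prodMk measurable_snd))

lemma stateExpect_zero (t : ℝ≥0) (x : Torus d) (i : Fin m) :
    stateExpect Q P f 0 t (x, i) =
      Q.holdingLaw i (Set.Ioi (t : ℝ≥0∞)) * ∫⁻ y, f (y, i) ∂semigroup (P i) t x := by
  have hfi : Measurable fun y => f (y, i) := hf.comp measurable_prodMk_right
  rw [stateExpect, lintegral_stageKernel _ _ _ (measurable_stageExpect Q P hf 0 t),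
    lintegral_semigroup _ _ _ hfi, ← lintegral_indicator_one
    measurableSet_Ioi, ← lintegral_mul_const _ (measurable_one.indicator measurableSet_Ioi)]
  refine lintegral_congr fun τ => ?_
  by_cases h : (t : ℝ≥0∞) < τ <;> simp [stageExpect, h]

/-- Decomposition at the first jump time `τ`. The path is independent of `τ`, so only its marginal
at `τ` matters, that is, the semigroup. -/
lemma stateExpect_succ (n : ℕ) (t : ℝ≥0) (x : Torus d) (i : Fin m) :
    stateExpect Q P f (n + 1) t (x, i) =
      ∫⁻ τ, (if τ ≤ (t : ℝ≥0∞) then ∫⁻ y, ∫⁻ j, stateExpect Q P f n (t - τ.toNNReal) (y, j)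
        ∂Q.jumpLaw i ∂semigroup (P i) τ.toNNReal x else 0) ∂Q.holdingLaw i := by
  rw [stateExpect, lintegral_stageKernel _ _ _ (measurable_stageExpect Q P hf (n + 1) t)]
  refine lintegral_congr fun τ => ?_
  by_cases h : τ ≤ (t : ℝ≥0∞)
  · simp only [stageExpect, h, if_true]
    rw [lintegral_semigroup _ _ _
      (measurable_lintegral_jumpLaw_stateExpect Q P hf n i measurable_const measurable_id')]
    refine lintegral_congr fun ω => ?_
    rw [lintegral_stepKernel _ _ _ (measurable_stageExpect Q P hf n _)]
    rfl
  · simp [stageExpect, h]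

end Expectation

/-! ### The flow property by induction on the number of jumps -/

section Semigroup

variable {d m : ℕ} (Q : RateMatrix m) (P : Fin m → Kernel (Torus d) (Path d))
  [∀ i, IsMarkovKernel (P i)]

omit [∀ i, IsMarkovKernel (P i)] in
lemma lintegral_semigroup_add
    (hP : ∀ i s t, semigroup (P i) (s + t) = semigroup (P i) t ∘ₖ semigroup (P i) s)
    (i : Fin m) (s t : ℝ≥0) (x : Torus d) {g : Torus d → ℝ≥0∞} (hg : Measurable g) :
    ∫⁻ y, g y ∂semigroup (P i) (s + t) x =
      ∫⁻ y, ∫⁻ y', g y' ∂semigroup (P i) t y ∂semigroup (P i) s x := by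
  rw [hP, Kernel.lintegral_comp _ _ _ hg]

/-- The flow property, refined by the numbers of jumps before and after time `t`. -/
lemma stateExpect_add
    (hP : ∀ i s t, semigroup (P i) (s + t) = semigroup (P i) t ∘ₖ semigroup (P i) s)
    {f : State d m → ℝ≥0∞} (hf : Measurable f) (s : ℝ≥0) (n : ℕ) (t : ℝ≥0) (z : State d m) :
    stateExpect Q P f n (t + s) z =
      ∑ p ∈ Finset.HasAntidiagonal.antidiagonal n,
        stateExpect Q P (stateExpect Q P f p.2 s) p.1 t z := by
  induction n generalizing t z with
  | zero =>
    obtain ⟨x, i⟩ := z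
    have h0 := measurable_stateExpect Q P hf 0 s
    have hfi : Measurable fun y => f (y, i) := hf.comp measurable_prodMk_right
    simp only [Finset.HasAntidiagonal.antidiagonal_zero, Finset.sum_singleton]
    rw [stateExpect_zero _ _ hf, stateExpect_zero _ _ h0, Q.holdingLaw_Ioi_add,
      lintegral_semigroup_add P hP _ _ _ _ hfi]
    simp_rw [stateExpect_zero Q P hf]
    rw [lintegral_const_mul _ hfi.lintegral_kernel, mul_assoc]
  | succ n ih =>
    obtain ⟨x, i⟩ := z
    have hU : ∀ k, Measurable (stateExpect Q P f k s) := fun k =>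
      measurable_stateExpect Q P hf k s
    -- `A` treats a first jump at `τ ≤ t`. `B` treats a first jump at `t + σ`, with `y` the position
    -- at `t` and `y'` the position at the jump.
    set A : ℝ≥0∞ → ℝ≥0∞ := fun τ => if τ ≤ (t : ℝ≥0∞) then
      ∫⁻ y, ∫⁻ j, stateExpect Q P f n (t + s - τ.toNNReal) (y, j)
        ∂Q.jumpLaw i ∂semigroup (P i) τ.toNNReal x else 0 with hA
    set B : ℝ≥0∞ → ℝ≥0∞ := fun σ => if σ ≤ (s : ℝ≥0∞) then
      ∫⁻ y, ∫⁻ y', ∫⁻ j, stateExpect Q P f n (s - σ.toNNReal) (y', j)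
        ∂Q.jumpLaw i ∂semigroup (P i) σ.toNNReal y ∂semigroup (P i) t x else 0 with hB
    have hAm : Measurable A :=
      Measurable.ite measurableSet_Iic
        (measurable_lintegral_semigroup (P i) (G := fun q : ℝ≥0∞ × Torus d =>
          ∫⁻ j, stateExpect Q P f n (t + s - q.1.toNNReal) (q.2, j) ∂Q.jumpLaw i)
          (measurable_lintegral_jumpLaw_stateExpect Q P hf n i
            (measurable_const.sub measurable_fst.ennreal_toNNReal) measurable_snd)
          ENNReal.measurable_toNNReal measurable_const) measurable_const
    have hB' : Measurable fun q : ℝ≥0∞ × Torus d =>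
        ∫⁻ y', ∫⁻ j, stateExpect Q P f n (s - q.1.toNNReal) (y', j)
          ∂Q.jumpLaw i ∂semigroup (P i) q.1.toNNReal q.2 :=
      measurable_lintegral_semigroup (P i) (G := fun r : (ℝ≥0∞ × Torus d) × Torus d =>
          ∫⁻ j, stateExpect Q P f n (s - r.1.1.toNNReal) (r.2, j) ∂Q.jumpLaw i)
        (measurable_lintegral_jumpLaw_stateExpect Q P hf n i
          (measurable_const.sub measurable_fst.fst.ennreal_toNNReal) measurable_snd)
        measurable_fst.ennreal_toNNReal measurable_snd
    have hBm : Measurable B := Measurable.ite measurableSet_Iic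
      (hB'.lintegral_prod_right' (ν := semigroup (P i) t x)) measurable_const
    have hsplit : stateExpect Q P f (n + 1) (t + s) (x, i) = ∫⁻ τ, A τ ∂Q.holdingLaw i +
        ∫⁻ τ, (if (t : ℝ≥0∞) < τ then B (τ - t) else 0) ∂Q.holdingLaw i := by
      rw [stateExpect_succ _ _ hf, ← lintegral_add_left hAm]
      refine lintegral_congr fun τ => ?_
      rcases le_or_gt τ (t : ℝ≥0∞) with h | h
      · have h' : τ ≤ ((t + s : ℝ≥0) : ℝ≥0∞) := h.trans (by simp)
        simp only [hA, h, h', h.not_gt, if_true, if_false, add_zero]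
      · have e1 : (τ ≤ ((t + s : ℝ≥0) : ℝ≥0∞)) ↔ τ - t ≤ s := by
          rw [tsub_le_iff_left, ENNReal.coe_add]
        simp only [hA, hB, h, h.not_ge, if_true, if_false, zero_add, e1]
        split_ifs with h2
        · lift τ to ℝ≥0 using ne_top_of_le_ne_top ENNReal.coe_ne_top (e1.2 h2)
          have h3 : t ≤ τ := (ENNReal.coe_lt_coe.1 h).le
          have e2 : ((τ : ℝ≥0∞) - t).toNNReal = τ - t := by
            rw [← ENNReal.coe_sub, ENNReal.toNNReal_coe]
          rw [e2, ENNReal.toNNReal_coe, ← lintegral_semigroup_add P hP _ _ _ _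
            (measurable_lintegral_jumpLaw_stateExpect Q P hf n i measurable_const measurable_id'),
            add_tsub_cancel_of_le h3]
          have e3 : t + s - τ = s - (τ - t) := by
            conv_lhs => rw [← add_tsub_cancel_of_le h3]
            rw [add_tsub_add_eq_tsub_left]
          rw [e3]
        · rfl
    -- After a first jump at `τ ≤ t`, the induction hypothesis applies with the remaining time `t -
    -- τ`; the jump just made raises the count before `t` to `p.1 + 1`.
    have hfirst : ∫⁻ τ, A τ ∂Q.holdingLaw i = ∑ p ∈ Finset.HasAntidiagonal.antidiagonal n,
        stateExpect Q P (stateExpect Q P f p.2 s) (p.1 + 1) t (x, i) := by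
      simp_rw [stateExpect_succ Q P (hU _)]
      rw [← lintegral_finsetSum]
      · refine lintegral_congr fun τ => ?_
        by_cases h : τ ≤ (t : ℝ≥0∞)
        · simp only [hA, h, if_true]
          rw [← lintegral_finsetSum _ fun p _ =>
            measurable_lintegral_jumpLaw_stateExpect Q P (hU p.2) p.1 i measurable_const
              measurable_id']
          refine lintegral_congr fun y => ?_
          rw [← lintegral_finsetSum _ fun p _ => measurable_of_finite _]
          refine lintegral_congr fun j => ?_
          lift τ to ℝ≥0 using ne_top_of_le_ne_top ENNReal.coe_ne_top h
          rw [← ih, ENNReal.toNNReal_coe, tsub_add_eq_add_tsub (ENNReal.coe_le_coe.1 h)]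
        · simp [hA, h]
      · intro p _
        exact Measurable.ite measurableSet_Iic
          (measurable_lintegral_semigroup (P i) (G := fun q : ℝ≥0∞ × Torus d =>
            ∫⁻ j, stateExpect Q P (stateExpect Q P f p.2 s) p.1 (t - q.1.toNNReal) (q.2, j)
              ∂Q.jumpLaw i)
            (measurable_lintegral_jumpLaw_stateExpect Q P (hU p.2) p.1 i
              (measurable_const.sub measurable_fst.ennreal_toNNReal) measurable_snd)
            ENNReal.measurable_toNNReal measurable_const) measurable_const
    -- If the first jump comes after `t`, lack of memory restarts the holding time at `t`: no jump
    -- before `t`, and `n + 1` after it.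
    have hsecond : ∫⁻ τ, (if (t : ℝ≥0∞) < τ then B (τ - t) else 0) ∂Q.holdingLaw i =
        stateExpect Q P (stateExpect Q P f (n + 1) s) 0 t (x, i) := by
      rw [Q.lintegral_holdingLaw_sub i t hBm, stateExpect_zero _ _ (hU _)]
      simp_rw [stateExpect_succ Q P hf]
      rw [lintegral_lintegral_swap]
      · congr 1
        refine lintegral_congr fun τ => ?_
        by_cases h : τ ≤ (s : ℝ≥0∞) <;> simp [hB, h]
      · exact (Measurable.ite (measurableSet_le measurable_snd measurable_const)
          (hB'.comp measurable_swap) measurable_const).aemeasurable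
    rw [Finset.Nat.sum_antidiagonal_succ, hsplit, hfirst, hsecond, add_comm]

end Semigroup

/-! ### The law of the switched process -/

section Trajectory

variable {d m : ℕ} (Q : RateMatrix m) (P : Fin m → Kernel (Torus d) (Path d))
  [∀ i, IsMarkovKernel (P i)] (ν : Measure (State d m)) [IsProbabilityMeasure ν]

instance : IsProbabilityMeasure (stageMeasure Q P ν) := by
  unfold stageMeasure; infer_instance

omit [IsProbabilityMeasure ν] in
lemma lintegral_stageMeasure_zero {F : Stage d m → ℝ≥0∞} (hF : Measurable F) :
    ∫⁻ e, F (e 0) ∂stageMeasure Q P ν = ∫⁻ z, ∫⁻ s, F s ∂stageKernel Q P z ∂ν := by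
  have h0 : Measurable fun h : Finset.Iic 0 → Stage d m => F (h ⟨0, Finset.mem_Iic.2 le_rfl⟩) :=
    hF.comp (measurable_pi_apply _)
  have h1 : ∀ e : ℕ → Stage d m, F (e 0) =
      F (Preorder.frestrictLe (π := fun _ => Stage d m) 0 e ⟨0, Finset.mem_Iic.2 le_rfl⟩) :=
    fun _ => rfl
  simp_rw [h1]
  rw [← lintegral_map h0 (Preorder.measurable_frestrictLe 0), stageMeasure, Kernel.trajMeasure,
    Measure.map_comp _ _ (Preorder.measurable_frestrictLe 0), Kernel.traj_map_frestrictLe,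
    Kernel.partialTraj_self, Measure.id_comp, lintegral_map h0 (MeasurableEquiv.measurable _)]
  exact Measure.lintegral_bind (stageKernel Q P).aemeasurable hF.aemeasurable

/-- The Markov property of the sequence of stages, from the Ionescu-Tulcea construction: the law of
the next stage looks only at the last one. -/
lemma lintegral_stageMeasure_succ (n : ℕ) {F : (Finset.Iic n → Stage d m) × Stage d m → ℝ≥0∞}
    (hF : Measurable F) :
    ∫⁻ e, F (Preorder.frestrictLe n e, e (n + 1)) ∂stageMeasure Q P ν =
      ∫⁻ e, ∫⁻ s, F (Preorder.frestrictLe n e, s) ∂stepKernel Q P (e n) ∂stageMeasure Q P ν := by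
  have hm : Measurable fun e : ℕ → Stage d m =>
      (Preorder.frestrictLe (π := fun _ => Stage d m) n e, e (n + 1)) :=
    (Preorder.measurable_frestrictLe n).prodMk (measurable_pi_apply _)
  rw [← lintegral_map hF hm, stageMeasure,
    ← Kernel.map_frestrictLe_trajMeasure_compProd_eq_map_trajMeasure,
    Measure.lintegral_compProd hF, lintegral_map (hF.lintegral_kernel_prod_right')
      (Preorder.measurable_frestrictLe n)]
  rfl

end Trajectory

/-! ### Nonexplosion, and the law of the process as a sum over jump counts -/

section Law

variable {d m : ℕ} (Q : RateMatrix m) (P : Fin m → Kernel (Torus d) (Path d))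
  [∀ i, IsMarkovKernel (P i)] (ν : Measure (State d m)) [IsProbabilityMeasure ν]

/-- The jump time that ends the last of finitely many stages. -/
def historyTime {n : ℕ} (h : Finset.Iic n → Stage d m) : ℝ≥0∞ := ∑ i, (h i).2.1

lemma measurable_historyTime (n : ℕ) : Measurable (historyTime (d := d) (m := m) (n := n)) :=
  Finset.measurable_sum _ fun k _ => (measurable_pi_apply k).snd.fst

lemma historyTime_frestrictLe (n : ℕ) (e : ℕ → Stage d m) :
    historyTime (Preorder.frestrictLe n e) = jumpTime e (n + 1) := by
  unfold historyTime jumpTime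
  rw [Nat.range_succ_eq_Iic]
  exact Finset.sum_coe_sort (Finset.Iic n) fun k => (e k).2.1

lemma jumpTime_succ (e : ℕ → Stage d m) (n : ℕ) :
    jumpTime e (n + 1) = jumpTime e n + (e n).2.1 :=
  Finset.sum_range_succ _ _

lemma jumpTime_monotone (e : ℕ → Stage d m) : Monotone (jumpTime e) :=
  monotone_nat_of_le_succ fun n => by rw [jumpTime_succ]; exact le_self_add

section Nonexplosion

variable {Q} {ρ : ℝ≥0∞} (hρ : ∀ i, ∫⁻ τ, RateMatrix.expNeg τ ∂Q.holdingLaw i ≤ ρ)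

include hρ in
lemma lintegral_expNeg_stageKernel_le (z : State d m) :
    ∫⁻ s, RateMatrix.expNeg s.2.1 ∂stageKernel Q P z ≤ ρ := by
  have hm : Measurable fun s : Stage d m => RateMatrix.expNeg s.2.1 :=
    RateMatrix.measurable_expNeg.comp measurable_snd.fst
  rw [lintegral_stageKernel Q P z hm]
  simpa using hρ z.2

include hρ in
lemma lintegral_expNeg_jumpTime_le (n : ℕ) :
    ∫⁻ e, RateMatrix.expNeg (jumpTime e n) ∂stageMeasure Q P ν ≤ ρ ^ n := by
  have hm : Measurable fun s : Stage d m => RateMatrix.expNeg s.2.1 :=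
    RateMatrix.measurable_expNeg.comp measurable_snd.fst
  induction n with
  | zero => simp [jumpTime, RateMatrix.expNeg_zero]
  | succ n ih =>
    simp_rw [jumpTime_succ, RateMatrix.expNeg_add]
    -- Stage `0` is drawn from the initial law rather than from `stepKernel`. Each later holding
    -- time contributes a factor at most `ρ` given the past, whatever the new mode.
    cases n with
    | zero =>
      simp only [jumpTime, Finset.range_zero, Finset.sum_empty, RateMatrix.expNeg_zero, one_mul,
        zero_add, pow_one]
      rw [lintegral_stageMeasure_zero Q P ν hm]
      calc _ ≤ ∫⁻ _, ρ ∂ν := lintegral_mono (lintegral_expNeg_stageKernel_le P hρ)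
        _ = ρ := by simp
    | succ n =>
      simp_rw [← historyTime_frestrictLe] at ih ⊢
      rw [lintegral_stageMeasure_succ Q P ν n (F := fun p =>
        RateMatrix.expNeg (historyTime p.1) * RateMatrix.expNeg p.2.2.1)
        ((RateMatrix.measurable_expNeg.comp
          ((measurable_historyTime n).comp measurable_fst)).mul (hm.comp measurable_snd))]
      calc _ ≤ ∫⁻ e, RateMatrix.expNeg (historyTime (Preorder.frestrictLe n e)) * ρ
            ∂stageMeasure Q P ν := by
            refine lintegral_mono fun e => ?_
            dsimp only
            rw [lintegral_const_mul _ hm, lintegral_stepKernel Q P _ hm]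
            gcongr
            calc _ ≤ ∫⁻ _, ρ ∂Q.jumpLaw (e n).2.2 :=
                  lintegral_mono fun j => lintegral_expNeg_stageKernel_le P hρ _
              _ = ρ := by simp
        _ = (∫⁻ e, RateMatrix.expNeg (historyTime (Preorder.frestrictLe n e))
            ∂stageMeasure Q P ν) * ρ :=
            lintegral_mul_const _ (RateMatrix.measurable_expNeg.comp
              ((measurable_historyTime n).comp (Preorder.measurable_frestrictLe n)))
        _ ≤ ρ ^ (n + 1) * ρ := by gcongr
        _ = _ := by rw [← pow_succ]

end Nonexplosion

/-- Almost surely, the mode jumps finitely often before each time. -/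
lemma ae_exists_lt_jumpTime (t : ℝ≥0) :
    ∀ᵐ e ∂stageMeasure Q P ν, ∃ n, (t : ℝ≥0∞) < jumpTime e n := by
  obtain ⟨ρ, hρ1, hρ⟩ := Q.exists_lintegral_expNeg_holdingLaw_le
  set S := {e : ℕ → Stage d m | ¬ ∃ n, (t : ℝ≥0∞) < jumpTime e n} with hS
  -- Markov's inequality: on `S` every `T_n` is at most `t`, so `e^{-t}` times the measure of `S` is
  -- at most `E e^{-T_n} ≤ ρ ^ n`, which tends to `0`.
  have h1 : ∀ n, RateMatrix.expNeg t * stageMeasure Q P ν S ≤ ρ ^ n := fun n => by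
    calc _ ≤ RateMatrix.expNeg t *
          stageMeasure Q P ν {e | RateMatrix.expNeg t ≤ RateMatrix.expNeg (jumpTime e n)} := by
          gcongr
          intro e he
          simp only [hS, Set.mem_ofPred_eq, not_exists, not_lt] at he
          exact RateMatrix.expNeg_antitone (he n)
      _ ≤ ∫⁻ e, RateMatrix.expNeg (jumpTime e n) ∂stageMeasure Q P ν :=
          mul_meas_ge_le_lintegral
            (RateMatrix.measurable_expNeg.comp (measurable_jumpTime n)) _
      _ ≤ _ := lintegral_expNeg_jumpTime_le P ν hρ n
  have h2 : RateMatrix.expNeg t * stageMeasure Q P ν S ≤ 0 :=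
    ge_of_tendsto' (ENNReal.tendsto_pow_atTop_nhds_zero_of_lt_one hρ1) h1
  rw [nonpos_iff_eq_zero, mul_eq_zero] at h2
  exact h2.resolve_left (RateMatrix.expNeg_coe_pos t).ne'

omit [∀ i, IsMarkovKernel (P i)] in
lemma ite_jumpTime_stageExpect_succ (f : State d m → ℝ≥0∞) (k n : ℕ) (t : ℝ≥0)
    (e : ℕ → Stage d m) :
    (if jumpTime e k ≤ t then
      stageExpect Q P f (n + 1) (t - (jumpTime e k).toNNReal) (e k) else 0) =
      if jumpTime e (k + 1) ≤ t then
        ∫⁻ s, stageExpect Q P f n (t - (jumpTime e (k + 1)).toNNReal) s ∂stepKernel Q P (e k)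
      else 0 := by
  rw [jumpTime_succ]
  by_cases h : jumpTime e k ≤ t
  · rw [if_pos h, stageExpect]
    obtain ⟨a, ha⟩ : ∃ a : ℝ≥0, (a : ℝ≥0∞) = jumpTime e k :=
      ⟨_, ENNReal.coe_toNNReal (ne_top_of_le_ne_top ENNReal.coe_ne_top h)⟩
    rw [← ha] at h ⊢
    have h' := ENNReal.coe_le_coe.1 h
    have e1 : ((e k).2.1 ≤ ((t - a : ℝ≥0) : ℝ≥0∞)) ↔ ↑a + (e k).2.1 ≤ t := by
      rw [ENNReal.coe_sub, ENNReal.le_sub_iff_add_le_left ENNReal.coe_ne_top h]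
    rw [ENNReal.toNNReal_coe]
    by_cases h2 : ↑a + (e k).2.1 ≤ (t : ℝ≥0∞)
    · have h3 : (e k).2.1 ≠ ∞ :=
        ne_top_of_le_ne_top ENNReal.coe_ne_top (le_add_self.trans h2)
      rw [if_pos (e1.2 h2), if_pos h2, ENNReal.toNNReal_add ENNReal.coe_ne_top h3,
        ENNReal.toNNReal_coe, tsub_add_eq_tsub_tsub]
    · rw [if_neg (mt e1.1 h2), if_neg h2]
  · rw [if_neg h, if_neg fun h2 => h (le_self_add.trans h2)]

variable {f : State d m → ℝ≥0∞} (hf : Measurable f)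
include hf

/-- Each step of the induction replaces a stage averaged inside `stageExpect` by the stage actually
drawn in the trajectory. At `k = 0` this links the recursion to the event of exactly `n` jumps. -/
lemma lintegral_ite_jumpTime_stageExpect (n k : ℕ) (t : ℝ≥0) :
    ∫⁻ e, (if jumpTime e k ≤ t then
      stageExpect Q P f n (t - (jumpTime e k).toNNReal) (e k) else 0) ∂stageMeasure Q P ν =
    ∫⁻ e, (if jumpTime e (k + n) ≤ t then
      stageExpect Q P f 0 (t - (jumpTime e (k + n)).toNNReal) (e (k + n)) else 0)
        ∂stageMeasure Q P ν := by
  induction n generalizing k with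
  | zero => rfl
  | succ n ih =>
    simp_rw [ite_jumpTime_stageExpect_succ]
    rw [← add_assoc, add_right_comm, ← ih (k + 1)]
    simp_rw [← historyTime_frestrictLe k]
    rw [lintegral_stageMeasure_succ Q P ν k (F := fun p => if historyTime p.1 ≤ t then
      stageExpect Q P f n (t - (historyTime p.1).toNNReal) p.2 else 0)]
    · refine lintegral_congr fun e => ?_
      split_ifs with h <;> simp
    · have h1 : Measurable fun p : (Finset.Iic k → Stage d m) × Stage d m => historyTime p.1 :=
        (measurable_historyTime k).comp measurable_fst
      exact Measurable.ite (measurableSet_le h1 measurable_const)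
        (measurable_stageExpect_comp Q P hf n (measurable_const.sub h1.ennreal_toNNReal)
          measurable_snd) measurable_const

omit [∀ i, IsMarkovKernel (P i)] hf in
-- The only nonzero term can be the one with `T_n ≤ t < T_{n+1}`, namely `n = jumpCount t e`. The
-- hypothesis `he` excludes the default value `sInf ∅ = 0`.
lemma apply_switchedProcess_eq_tsum (f : State d m → ℝ≥0∞) (t : ℝ≥0) {e : ℕ → Stage d m}
    (he : ∃ n, (t : ℝ≥0∞) < jumpTime e n) :
    f (switchedProcess t e) = ∑' n, if jumpTime e n ≤ t then
      stageExpect Q P f 0 (t - (jumpTime e n).toNNReal) (e n) else 0 := by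
  have hterm : ∀ n, (if jumpTime e n ≤ t then
      stageExpect Q P f 0 (t - (jumpTime e n).toNNReal) (e n) else 0) =
      if jumpTime e n ≤ t ∧ (t : ℝ≥0∞) < jumpTime e (n + 1) then
        f ((e n).1.eval (t - (jumpTime e n).toNNReal), (e n).2.2) else 0 := by
    intro n
    by_cases h : jumpTime e n ≤ t
    · simp only [stageExpect, h, if_true, true_and]
      obtain ⟨a, ha⟩ : ∃ a : ℝ≥0, (a : ℝ≥0∞) = jumpTime e n :=
      ⟨_, ENNReal.coe_toNNReal (ne_top_of_le_ne_top ENNReal.coe_ne_top h)⟩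
      rw [jumpTime_succ, ← ha, ENNReal.toNNReal_coe, ENNReal.coe_sub]
      rw [← ha] at h
      congr 1
      rw [ENNReal.sub_lt_iff_lt_left ENNReal.coe_ne_top h]
    · simp [h]
  simp_rw [hterm]
  have hne : {n | (t : ℝ≥0∞) < jumpTime e (n + 1)}.Nonempty := by
    obtain ⟨n, hn⟩ := he
    exact ⟨n, hn.trans_le (jumpTime_monotone e n.le_succ)⟩
  have hlt : (t : ℝ≥0∞) < jumpTime e (jumpCount t e + 1) := Nat.sInf_mem hne
  have hmin : ∀ n, (t : ℝ≥0∞) < jumpTime e (n + 1) → jumpCount t e ≤ n := fun n hn =>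
    Nat.sInf_le hn
  have hle : jumpTime e (jumpCount t e) ≤ t := by
    rcases Nat.eq_zero_or_eq_succ_pred (jumpCount t e) with h | h
    · rw [h]
      simp [jumpTime]
    · by_contra hc
      rw [h, not_le] at hc
      have := hmin _ hc
      omega
  rw [tsum_eq_single (jumpCount t e), if_pos ⟨hle, hlt⟩]
  · rfl
  · intro n hn
    refine if_neg fun h => hn ?_
    refine le_antisymm ?_ (hmin n h.2)
    by_contra hc
    exact absurd (hlt.trans_le ((jumpTime_monotone e (by omega)).trans h.1)) (lt_irrefl _)

/-- The law of the switched process, decomposed according to the number of jumps. -/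
lemma lintegral_switchedLaw (t : ℝ≥0) :
    ∫⁻ z, f z ∂switchedLaw Q P ν t = ∑' n, ∫⁻ z, stateExpect Q P f n t z ∂ν := by
  rw [switchedLaw, lintegral_map hf (measurable_switchedProcess t)]
  have hm : ∀ n, Measurable fun e : ℕ → Stage d m => if jumpTime e n ≤ t then
      stageExpect Q P f 0 (t - (jumpTime e n).toNNReal) (e n) else 0 := fun n =>
    Measurable.ite (measurableSet_le (measurable_jumpTime n) measurable_const)
      (measurable_stageExpect_comp Q P hf 0
        (measurable_const.sub (measurable_jumpTime n).ennreal_toNNReal) (measurable_pi_apply n))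
      measurable_const
  rw [lintegral_congr_ae ((ae_exists_lt_jumpTime Q P ν t).mono fun e he =>
    apply_switchedProcess_eq_tsum Q P f t he), lintegral_tsum fun n => (hm n).aemeasurable]
  refine tsum_congr fun n => ?_
  have h := lintegral_ite_jumpTime_stageExpect Q P ν hf n 0 t
  rw [zero_add] at h
  rw [← h]
  simpa [jumpTime, stateExpect] using
    lintegral_stageMeasure_zero Q P ν (measurable_stageExpect Q P hf n t)

end Law

/-! ### The semigroup of the switched process and its minorization -/

section Switched

variable {d m : ℕ} (Q : RateMatrix m) (P : Fin m → Kernel (Torus d) (Path d))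
  [∀ i, IsMarkovKernel (P i)]

instance (ν : Measure (State d m)) [IsProbabilityMeasure ν] (t : ℝ≥0) :
    IsProbabilityMeasure (switchedLaw Q P ν t) :=
  Measure.isProbabilityMeasure_map (measurable_switchedProcess t).aemeasurable

/-- The semigroup of the switched process. -/
def switchedKernel (t : ℝ≥0) : Kernel (State d m) (State d m) :=
  ⟨fun z => switchedLaw Q P (Measure.dirac z) t,
    Measure.measurable_of_measurable_coe _ fun A hA => by
      have hf : Measurable (A.indicator (1 : State d m → ℝ≥0∞)) := measurable_one.indicator hA
      simp_rw [← lintegral_indicator_one hA, lintegral_switchedLaw Q P _ hf,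
        lintegral_dirac' _ (measurable_stateExpect Q P hf _ t)]
      exact Measurable.tsum fun n => measurable_stateExpect Q P hf n t⟩

instance (t : ℝ≥0) : IsMarkovKernel (switchedKernel Q P t) :=
  ⟨fun z => inferInstanceAs (IsProbabilityMeasure (switchedLaw Q P (Measure.dirac z) t))⟩

lemma lintegral_switchedKernel (t : ℝ≥0) (z : State d m) {f : State d m → ℝ≥0∞}
    (hf : Measurable f) :
    ∫⁻ y, f y ∂switchedKernel Q P t z = ∑' n, stateExpect Q P f n t z := by
  change ∫⁻ y, f y ∂switchedLaw Q P (Measure.dirac z) t = _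
  simp_rw [lintegral_switchedLaw Q P _ hf, lintegral_dirac' _ (measurable_stateExpect Q P hf _ t)]

lemma switchedLaw_eq_bind (ν : Measure (State d m)) [IsProbabilityMeasure ν] (t : ℝ≥0) :
    switchedLaw Q P ν t = ν.bind (switchedKernel Q P t) := by
  ext A hA
  have hf : Measurable (A.indicator (1 : State d m → ℝ≥0∞)) := measurable_one.indicator hA
  rw [Measure.bind_apply hA (switchedKernel Q P t).aemeasurable, ← lintegral_indicator_one hA,
    lintegral_switchedLaw Q P ν hf,
    ← lintegral_tsum fun n => (measurable_stateExpect Q P hf n t).aemeasurable]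
  refine lintegral_congr fun z => ?_
  rw [← lintegral_indicator_one hA, lintegral_switchedKernel Q P t z hf]

variable {P} in
-- Summing `stateExpect_add` over `n` turns the antidiagonals into a double sum over jumps before
-- and after `t`; in `[0, ∞]` the rearrangement is free.
lemma switchedKernel_add
    (hP : ∀ i s t, semigroup (P i) (s + t) = semigroup (P i) t ∘ₖ semigroup (P i) s)
    (t s : ℝ≥0) :
    switchedKernel Q P (t + s) = switchedKernel Q P s ∘ₖ switchedKernel Q P t := by
  ext z A hA
  set f := A.indicator (1 : State d m → ℝ≥0∞)
  have hf : Measurable f := measurable_one.indicator hA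
  rw [← lintegral_indicator_one hA, ← lintegral_indicator_one hA, Kernel.lintegral_comp _ _ _ hf]
  simp_rw [lintegral_switchedKernel Q P _ _ hf]
  rw [lintegral_tsum fun n => (measurable_stateExpect Q P hf n s).aemeasurable]
  simp_rw [lintegral_switchedKernel Q P _ _ (measurable_stateExpect Q P hf _ s)]
  rw [lintegral_switchedKernel Q P (t + s) z hf,
    tsum_congr fun n => stateExpect_add Q P hP hf s n t z]
  calc ∑' n, ∑ p ∈ Finset.HasAntidiagonal.antidiagonal n,
        stateExpect Q P (stateExpect Q P f p.2 s) p.1 t z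
      = ∑' n, ∑' p : Finset.HasAntidiagonal.antidiagonal n,
        stateExpect Q P (stateExpect Q P f p.1.2 s) p.1.1 t z := by
        refine tsum_congr fun n => ?_
        rw [tsum_fintype, Finset.sum_coe_sort (Finset.HasAntidiagonal.antidiagonal n)
          fun p => stateExpect Q P (stateExpect Q P f p.2 s) p.1 t z]
    _ = ∑' p : ℕ × ℕ, stateExpect Q P (stateExpect Q P f p.2 s) p.1 t z := by
        rw [← ENNReal.tsum_sigma, ← Finset.HasAntidiagonal.sigmaAntidiagonalEquivProd.tsum_eq]
        rfl
    _ = _ := by rw [ENNReal.tsum_prod', ENNReal.tsum_comm]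

lemma stateExpect_le_lintegral (n : ℕ) (t : ℝ≥0) (z : State d m) {f : State d m → ℝ≥0∞}
    (hf : Measurable f) : stateExpect Q P f n t z ≤ ∫⁻ y, f y ∂switchedKernel Q P t z := by
  rw [lintegral_switchedKernel Q P t z hf]
  exact ENNReal.le_tsum n

end Switched

/-! ### Lower bounds for the transition probabilities -/

section Minorization

variable {d m : ℕ} (Q : RateMatrix m) (P : Fin m → Kernel (Torus d) (Path d))
  [∀ i, IsMarkovKernel (P i)]

/-- The states of mode `j`. -/
def modeSet (d : ℕ) {m : ℕ} (j : Fin m) : Set (State d m) := Prod.snd ⁻¹' {j}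

lemma measurableSet_modeSet (j : Fin m) : MeasurableSet (modeSet d j) :=
  measurable_snd (measurableSet_singleton j)

lemma holdingLaw_le_switchedKernel_modeSet (t : ℝ≥0) (x : Torus d) (i : Fin m) :
    Q.holdingLaw i (Set.Ioi (t : ℝ≥0∞)) ≤ switchedKernel Q P t (x, i) (modeSet d i) := by
  have hf : Measurable ((modeSet d i).indicator (1 : State d m → ℝ≥0∞)) :=
    measurable_one.indicator (measurableSet_modeSet i)
  rw [← lintegral_indicator_one (measurableSet_modeSet i)]
  refine le_trans ?_ (stateExpect_le_lintegral Q P 0 t (x, i) hf)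
  rw [stateExpect_zero Q P hf]
  simp [modeSet]

/-- Only trajectories with exactly one jump are kept. The second holding time is asked to exceed all
of `t`, not just what remains, so that the bound does not depend on the jump time. -/
lemma jump_le_switchedKernel_modeSet (t : ℝ≥0) (x : Torus d) (i j : Fin m) :
    Q.holdingLaw i (Set.Iic (t : ℝ≥0∞)) *
      (Q.jumpLaw i {j} * Q.holdingLaw j (Set.Ioi (t : ℝ≥0∞)))
        ≤ switchedKernel Q P t (x, i) (modeSet d j) := by
  set f := (modeSet d j).indicator (1 : State d m → ℝ≥0∞)
  have hf : Measurable f := measurable_one.indicator (measurableSet_modeSet j)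
  have h0 : ∀ (s : ℝ≥0) (y : Torus d),
      stateExpect Q P f 0 s (y, j) = Q.holdingLaw j (Set.Ioi (s : ℝ≥0∞)) := fun s y => by
    rw [stateExpect_zero Q P hf]
    simp [f, modeSet]
  rw [← lintegral_indicator_one (measurableSet_modeSet j)]
  refine le_trans ?_ (stateExpect_le_lintegral Q P 1 t (x, i) hf)
  rw [stateExpect_succ Q P hf, ← lintegral_indicator_one measurableSet_Iic,
    ← lintegral_mul_const _ (measurable_one.indicator measurableSet_Iic)]
  refine lintegral_mono fun τ => ?_
  by_cases h : τ ≤ (t : ℝ≥0∞)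
  · simp only [h, if_true, Set.indicator_of_mem (Set.mem_Iic.2 h), Pi.one_apply, one_mul]
    have h1 : ∀ y, Q.jumpLaw i {j} * Q.holdingLaw j (Set.Ioi (t : ℝ≥0∞)) ≤
        ∫⁻ k, stateExpect Q P f 0 (t - τ.toNNReal) (y, k) ∂Q.jumpLaw i := fun y => by
      calc _ ≤ Q.holdingLaw j (Set.Ioi ((t - τ.toNNReal : ℝ≥0) : ℝ≥0∞)) * Q.jumpLaw i {j} := by
            rw [mul_comm]
            gcongr
            exact tsub_le_self
        _ = ∫⁻ k in {j}, stateExpect Q P f 0 (t - τ.toNNReal) (y, k) ∂Q.jumpLaw i := by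
            rw [lintegral_singleton, h0]
        _ ≤ _ := setLIntegral_le_lintegral _ _
    calc _ = ∫⁻ _, Q.jumpLaw i {j} * Q.holdingLaw j (Set.Ioi (t : ℝ≥0∞))
          ∂semigroup (P i) τ.toNNReal x := by simp
      _ ≤ _ := lintegral_mono h1
  · simp [h]

variable {Q P} in
/-- The mode reaches `j` from `i` in each time with a probability bounded below. -/
lemma exists_pos_le_switchedKernel_modeSet
    (hP : ∀ i s t, semigroup (P i) (s + t) = semigroup (P i) t ∘ₖ semigroup (P i) s)
    {i j : Fin m} (hij : Relation.ReflTransGen (fun a b => a ≠ b ∧ 0 < Q.rate a b) i j)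
    {t : ℝ≥0} (ht : 0 < t) :
    ∃ p : ℝ≥0∞, 0 < p ∧ ∀ x, p ≤ switchedKernel Q P t (x, i) (modeSet d j) := by
  induction hij generalizing t with
  | refl =>
    exact ⟨_, Q.holdingLaw_Ioi_pos i t,
      fun x => holdingLaw_le_switchedKernel_modeSet Q P t x i⟩
  | @tail b c _ hbc ih =>
    -- Half of the time is spent reaching `b`, half on the last jump to `c`; hence the induction is
    -- for all times at once.
    obtain ⟨p, hp, hpx⟩ := ih (half_pos ht)
    set q := Q.holdingLaw b (Set.Iic ((t / 2 : ℝ≥0) : ℝ≥0∞)) *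
      (Q.jumpLaw b {c} * Q.holdingLaw c (Set.Ioi ((t / 2 : ℝ≥0) : ℝ≥0∞)))
    have hq : 0 < q := ENNReal.mul_pos
      (Q.holdingLaw_Iic_pos (Q.exitRate_pos hbc.1 hbc.2) (half_pos ht)).ne'
      (ENNReal.mul_pos (Q.jumpLaw_singleton_pos hbc.1 hbc.2).ne'
        (Q.holdingLaw_Ioi_pos c _).ne').ne'
    refine ⟨q * p, ENNReal.mul_pos hq.ne' hp.ne', fun x => ?_⟩
    have ht2 : t = t / 2 + t / 2 := (add_halves t).symm
    rw [ht2, switchedKernel_add Q hP, Kernel.comp_apply' _ _ _ (measurableSet_modeSet c)]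
    calc q * p ≤ q * switchedKernel Q P (t / 2) (x, i) (modeSet d b) := by
          gcongr; exact hpx x
      _ = ∫⁻ _ in modeSet d b, q ∂switchedKernel Q P (t / 2) (x, i) := by
          rw [setLIntegral_const]
      _ ≤ ∫⁻ z in modeSet d b, switchedKernel Q P (t / 2) z (modeSet d c)
            ∂switchedKernel Q P (t / 2) (x, i) := by
          refine setLIntegral_mono_ae' (measurableSet_modeSet b) (ae_of_all _ fun z hz => ?_)
          obtain ⟨y, k⟩ := z
          obtain rfl : k = b := hz
          exact jump_le_switchedKernel_modeSet Q P (t / 2) y k c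
      _ ≤ _ := setLIntegral_le_lintegral _ _

variable {Q P} in
/-- If one mode satisfies the Doeblin condition and the mode process is irreducible, then the
switched process satisfies the Doeblin condition. -/
lemma exists_minorant_switchedKernel
    (hP : ∀ i s t, semigroup (P i) (s + t) = semigroup (P i) t ∘ₖ semigroup (P i) s)
    (hQ : Q.Irreducible) {i₀ : Fin m} (hD : Doeblin (P i₀)) :
    ∃ T : ℝ≥0, 0 < T ∧ ∃ μ : Measure (State d m), IsFiniteMeasure μ ∧ μ Set.univ ≠ 0 ∧
      ∀ z, μ ≤ switchedKernel Q P T z := by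
  obtain ⟨t₀, ht₀, c, hc, μ, hμ, hcμ⟩ := hD
  choose p hp hpx using fun i =>
    exists_pos_le_switchedKernel_modeSet (d := d) hP (hQ i i₀) (t := 1) one_pos
  set p₀ : ℝ≥0∞ := Finset.univ.inf p with hp₀
  have hp₀_pos : 0 < p₀ := (Finset.lt_inf_iff ENNReal.zero_lt_top).2 fun i _ => hp i
  have hp₀_le : ∀ i, p₀ ≤ p i := fun i => Finset.inf_le (Finset.mem_univ i)
  have hp₀_ne : p₀ ≠ ∞ := ne_top_of_le_ne_top ENNReal.one_ne_top
    ((hp₀_le i₀).trans ((hpx i₀ 0).trans prob_le_one))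
  -- Mass of the minorant: the mode is `i₀` at time `1`, does not jump for a further time `t₀`, and
  -- the diffusion of `i₀` contributes `c`.
  set a : ℝ≥0∞ := p₀ * (Q.holdingLaw i₀ (Set.Ioi (t₀ : ℝ≥0∞)) * c) with ha
  have ha0 : a ≠ 0 := mul_ne_zero hp₀_pos.ne'
    (mul_ne_zero (Q.holdingLaw_Ioi_pos i₀ t₀).ne' (by simpa using hc.ne'))
  have ha_top : a ≠ ∞ := ENNReal.mul_ne_top hp₀_ne
    (ENNReal.mul_ne_top (measure_ne_top _ _) ENNReal.coe_ne_top)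
  have hin : Measurable fun x : Torus d => ((x, i₀) : State d m) := measurable_prodMk_right
  have hprob : IsProbabilityMeasure (μ.map fun x : Torus d => ((x, i₀) : State d m)) :=
    Measure.isProbabilityMeasure_map hin.aemeasurable
  refine ⟨1 + t₀, by positivity, a • μ.map fun x => (x, i₀), Measure.smul_finite _ ha_top, ?_, ?_⟩
  · simpa using ha0
  rintro ⟨x, i⟩
  refine Measure.le_iff.2 fun A hA => ?_
  set f := A.indicator (1 : State d m → ℝ≥0∞)
  have hf : Measurable f := measurable_one.indicator hA
  have hfi : Measurable fun y => f (y, i₀) := hf.comp hin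
  set b := μ.map (fun x => (x, i₀)) A with hb
  have hstep : ∀ y, Q.holdingLaw i₀ (Set.Ioi (t₀ : ℝ≥0∞)) * (c * b) ≤
      switchedKernel Q P t₀ (y, i₀) A := fun y => by
    rw [← lintegral_indicator_one hA]
    refine le_trans ?_ (stateExpect_le_lintegral Q P 0 t₀ (y, i₀) hf)
    rw [stateExpect_zero Q P hf]
    gcongr
    calc c * b = ∫⁻ y, f (y, i₀) ∂(c • μ) := by
          rw [lintegral_smul_measure, hb, ← lintegral_indicator_one hA, lintegral_map hf hin]
          rfl
      _ ≤ _ := lintegral_mono' (hcμ y) le_rfl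
  rw [switchedKernel_add Q hP, Kernel.comp_apply' _ _ _ hA]
  calc (a • μ.map fun x => (x, i₀)) A
      = (Q.holdingLaw i₀ (Set.Ioi (t₀ : ℝ≥0∞)) * (c * b)) * p₀ := by
        rw [Measure.smul_apply, smul_eq_mul, ha, hb]
        ring
    _ ≤ (Q.holdingLaw i₀ (Set.Ioi (t₀ : ℝ≥0∞)) * (c * b)) *
          switchedKernel Q P 1 (x, i) (modeSet d i₀) := by
        gcongr
        exact (hp₀_le i).trans (hpx i x)
    _ = ∫⁻ _ in modeSet d i₀, Q.holdingLaw i₀ (Set.Ioi (t₀ : ℝ≥0∞)) * (c * b)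
          ∂switchedKernel Q P 1 (x, i) := by rw [setLIntegral_const]
    _ ≤ ∫⁻ z in modeSet d i₀, switchedKernel Q P t₀ z A ∂switchedKernel Q P 1 (x, i) := by
        refine setLIntegral_mono_ae' (measurableSet_modeSet i₀) (ae_of_all _ fun z hz => ?_)
        obtain ⟨y, k⟩ := z
        obtain rfl : k = i₀ := hz
        exact hstep y
    _ ≤ _ := setLIntegral_le_lintegral _ _

end Minorization

end SwitchedDiffusion

end

theorem mainTheorem3 (d n m : ℕ)
    (H : Fin m → SwitchedDiffusion.Torus d → Fin d → ℝ)
    (σ : Fin m → SwitchedDiffusion.Torus d → Matrix (Fin d) (Fin n) ℝ)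
    (hH : ∀ i, Measurable (H i)) (hσ : ∀ i k l, Measurable fun x => σ i x k l)
    (P : Fin m → ProbabilityTheory.Kernel (SwitchedDiffusion.Torus d) (SwitchedDiffusion.Path d))
    [∀ i, ProbabilityTheory.IsMarkovKernel (P i)]
    (hP : ∀ i, SwitchedDiffusion.IsDiffusion (H i) (σ i) (P i))
    (Q : SwitchedDiffusion.RateMatrix m) (hQ : Q.Irreducible)
    (i₀ : Fin m) (hD : SwitchedDiffusion.Doeblin (P i₀)) :
    ∃ π : MeasureTheory.Measure (SwitchedDiffusion.State d m),
      SwitchedDiffusion.IsInvariantProbability Q P π ∧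
      (∀ π', SwitchedDiffusion.IsInvariantProbability Q P π' → π' = π) ∧
      ∃ C : ℝ, 0 < C ∧ ∃ r : ℝ, 0 < r ∧
        ∀ ν : MeasureTheory.Measure (SwitchedDiffusion.State d m),
          MeasureTheory.IsProbabilityMeasure ν → ∀ t : NNReal,
            SwitchedDiffusion.tvDist (SwitchedDiffusion.switchedLaw Q P ν t) π
              ≤ C * Real.exp (-r * t) := by
  have hadd := fun i s t => (hP i).semigroup_add (hH i) (hσ i) s t
  obtain ⟨T, hT, μ, hμ, hμ0, hle⟩ := SwitchedDiffusion.exists_minorant_switchedKernel hadd hQ hD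
  obtain ⟨π, ⟨hπ, hinv⟩, huniq, C, hC, r, hr, hconv⟩ :=
    SwitchedDiffusion.exists_invariant_exponential_of_minorant
      (SwitchedDiffusion.switchedKernel_add Q hadd) hle hT (0, i₀) hμ0
  refine ⟨π, ⟨hπ, fun t => ?_⟩, fun π' h => huniq π' ⟨h.1, fun t => ?_⟩, C, hC, r, hr,
    fun ν hν t => ?_⟩
  · rw [SwitchedDiffusion.switchedLaw_eq_bind, hinv]
  · have := h.1
    rw [← SwitchedDiffusion.switchedLaw_eq_bind, h.2]
  · rw [SwitchedDiffusion.switchedLaw_eq_bind]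
    exact hconv ν hν t
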